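/- **Theorem 3.8.** Let $A$ be a ring, let $\operatorname{Mod}A$ be the category of left $A$-modules and $D=D(\operatorname{Mod}A)$ its (unbounded) derived category; modules are regarded as complexes concentrated in degree $0$. Let $d\colon P^{-1}\to P^{0}$ be a homomorphism between small projective $A$-modules (a module $M$ is small if $\operatorname{Hom}_A(M,-)$ commutes with direct sums; the small projective modules are the finitely generated projective ones), and let $P^{\bullet}$ be its mapping cone, with $P^0$ in degree $0$. Put $B=\operatorname{End}_{D}(P^{\bullet})^{\mathrm{op}}$ and $$\mathcal X(P^\bullet)=\{X\in\operatorname{Mod}A:\operatorname{Hom}_{D}(P^\bullet,X[1])=0\},\qquad \mathcal Y(P^\bullet)=\{X\in\operatorname{Mod}A:\operatorname{Hom}_{D}(P^\bullet,X)=0\},$$ and let $\mathcal C(P^\bullet)$ be the full subcategory of $D$ of all objects $X$ with $\operatorname{Hom}_{D}(P^\bullet,X[i])=0$ for all $i\neq 0$. Assume that $\mathcal X(P^\bullet)\cap\mathcal Y(P^\bullet)=\{0\}$ and $H^0(P^\bullet)\in\mathcal X(P^\bullet)$. Then the following hold. 1. $\{P^\bullet[i]: i\in\mathbb Z\}$ is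 a generating set for $D$: it is stable under shifts (up to isomorphism), each of its objects $K$ is compact (that is, $\operatorname{Hom}_{D}(K,-)$ commutes with direct sums), and every $X\in D$ with $\operatorname{Hom}_{D}(P^\bullet[i],X)=0$ for all $i\in\mathbb Z$ is zero. 2. $\mathcal C(P^\bullet)$ is admissible abelian: it is closed under finite direct sums, $\operatorname{Hom}_{D}(X,Y[n])=0$ for all $X,Y\in\mathcal C(P^\bullet)$ and $n<0$, and for every morphism $f\colon X\to Y$ in $\mathcal C(P^\bullet)$ and every distinguished triangle $X\xrightarrow{f}Y\to Z\to X[1]$ in $D$ there is a distinguished triangle $N[1]\to Z\to Q\to N[2]$ with $N,Q\in\mathcal C(P^\bullet)$. In particular $\mathcal C(P^\bullet)$ is an abelian category. 3. $\mathcal Y(P^\bullet)[1]$ and $\mathcal X(P^\bullet)$ are contained in $\mathcal C(P^\bullet)$, and $(\mathcal Y(P^\bullet)[1],\mathcal X(P^\bullet))$ (closed under isomorphisms in $\mathcal C(P^\bullet)$) is a torsion theory for $\mathcal C(P^\bullet)$. Here a pair $(\mathcal U,\mathcal V)$ of full subcategories of an abelian category is a torsion theory if $\mathcal U\cap\mathcal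 V=\{0\}$, $\mathcal U$ is closed under factor objects, $\mathcal V$ is closed under subobjects, and every object $M$ admits an exact sequence $0\to M'\to M\to M''\to 0$ with $M'\in\mathcal U$ and $M''\in\mathcal V$. 4. The functor $\operatorname{Hom}_{D}(P^\bullet,-)\colon\mathcal C(P^\bullet)\to\operatorname{Mod}B$ to left $B$-modules is an equivalence. -/

import Mathlib

open CategoryTheory CategoryTheory.Limits CategoryTheory.Pretriangulated

universe u w w'

namespace TwoTermComplex

section Preadditive

variable {C : Type w'} [Category.{w} C] [Preadditive C]

/-- `Hom(M, -)`, as a functor to abelian groups, commutes with direct sums indexed by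
arbitrary (`u`-small) sets. Such an object is called *small* when `C` is an abelian category
and *compact* when `C` is a triangulated category. -/
def HomCommutesWithDirectSums (M : C) : Prop :=
  ∀ J : Type u, PreservesColimitsOfShape (Discrete J) (preadditiveCoyoneda.obj (Opposite.op M))

/-- A pair `(X, Y)` of full subcategories of an (abelian) category is a torsion theory. -/
structure IsTorsionTheory (X Y : ObjectProperty C) : Prop where
  inter : ∀ M : C, (X M ∧ Y M) ↔ IsZero M
  of_epi : ∀ ⦃M N : C⦄ (f : M ⟶ N) [Epi f], X M → X N
  of_mono : ∀ ⦃M N : C⦄ (f : M ⟶ N) [Mono f], Y N → Y M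
  exists_shortExact : ∀ M : C, ∃ (M' M'' : C) (i : M' ⟶ M) (p : M ⟶ M'') (h : i ≫ p = 0),
    (ShortComplex.mk i p h).ShortExact ∧ X M' ∧ Y M''

end Preadditive

section Triangulated

variable {T : Type w'} [Category.{w} T] [Preadditive T] [HasZeroObject T] [HasShift T ℤ]
  [∀ n : ℤ, (shiftFunctor T n).Additive] [Pretriangulated T]

/-- `S` is a generating set for `T`: it consists of compact objects, it is stable under
suspension (and desuspension), and an object `X` with `Hom(S, X) = 0` is zero. -/
structure IsGeneratingSet (S : ObjectProperty T) : Prop where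
  compact : ∀ K : T, S K → HomCommutesWithDirectSums.{u} K
  stable : ∀ (K : T) (n : ℤ), S K → S (K⟦n⟧)
  isZero : ∀ X : T, (∀ K : T, S K → ∀ f : K ⟶ X, f = 0) → IsZero X

/-- The collection `{K[i] : i ∈ ℤ}`, up to isomorphism. -/
def shifts (K : T) : ObjectProperty T := fun L ↦ ∃ i : ℤ, Nonempty (L ≅ K⟦i⟧)

/-- The full subcategory `T^{≥ n}(K)`. -/
def homGE (K : T) (n : ℤ) : ObjectProperty T := fun X ↦ ∀ i : ℤ, i < n → ∀ f : K ⟶ X⟦i⟧, f = 0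

/-- The full subcategory `T^{≤ n}(K)`. -/
def homLE (K : T) (n : ℤ) : ObjectProperty T := fun X ↦ ∀ i : ℤ, n < i → ∀ f : K ⟶ X⟦i⟧, f = 0

/-- The full subcategory `T^0(K) = T^{≤ 0}(K) ∩ T^{≥ 0}(K)`. -/
def homHeart (K : T) : ObjectProperty T := homLE K 0 ⊓ homGE K 0

/-- A full subcategory `P` of `T` (stable under finite direct sums) is admissible abelian, in the
sense of Beilinson, Bernstein and Deligne: `Hom(X, Y[n]) = 0` for `X`, `Y` in `P` and `n < 0`, and
every morphism of `P` is `P`-admissible, i.e. any cone `Z` of it sits in a distinguished triangle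
`N[1] ⟶ Z ⟶ Q ⟶ N[2]` with `N` and `Q` in `P`. -/
structure IsAdmissibleAbelian (P : ObjectProperty T) : Prop where
  finite_sums : P.IsClosedUnderFiniteProducts
  hom_eq_zero : ∀ ⦃X Y : T⦄, P X → P Y → ∀ n : ℤ, n < 0 → ∀ f : X ⟶ Y⟦n⟧, f = 0
  admissible : Triangulated.AbelianSubcategory.admissibleMorphism P.ι = ⊤

end Triangulated

section Modules

variable {A : Type u} [Ring A] {M N : ModuleCat.{u} A} (d : M ⟶ N)

/-- The mapping cone of `d : M ⟶ N`, the complex `⋯ ⟶ 0 ⟶ M ⟶ N ⟶ 0 ⟶ ⋯` with `N` in degree `0`. -/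
noncomputable def cone : CochainComplex (ModuleCat.{u} A) ℤ :=
  CochainComplex.mappingCone ((CochainComplex.singleFunctor (ModuleCat.{u} A) 0).map d)

variable [HasDerivedCategory.{w} (ModuleCat.{u} A)]

/-- The mapping cone of `d`, as an object of the derived category `D(Mod A)`. -/
noncomputable def dCone : DerivedCategory (ModuleCat.{u} A) :=
  DerivedCategory.Q.obj (cone d)

/-- `𝒳(P) = {X ∈ Mod A : Hom_{D(Mod A)}(P, X[1]) = 0}` for an object `P` of `D(Mod A)`. -/
def classX (P : DerivedCategory (ModuleCat.{u} A)) : ObjectProperty (ModuleCat.{u} A) :=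
  fun X ↦ ∀ f : P ⟶ ((DerivedCategory.singleFunctor (ModuleCat.{u} A) 0).obj X)⟦(1 : ℤ)⟧, f = 0

/-- `𝒴(P) = {X ∈ Mod A : Hom_{D(Mod A)}(P, X) = 0}` for an object `P` of `D(Mod A)`. -/
def classY (P : DerivedCategory (ModuleCat.{u} A)) : ObjectProperty (ModuleCat.{u} A) :=
  fun X ↦ ∀ f : P ⟶ (DerivedCategory.singleFunctor (ModuleCat.{u} A) 0).obj X, f = 0

/-- `𝒳(P)` as a full subcategory of `D(Mod A)` (modules are complexes concentrated in degree `0`;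
closed under isomorphisms). -/
noncomputable def derivedX (P : DerivedCategory (ModuleCat.{u} A)) :
    ObjectProperty (DerivedCategory (ModuleCat.{u} A)) :=
  (classX P).map (DerivedCategory.singleFunctor (ModuleCat.{u} A) 0)

/-- `𝒴(P)[1]` as a full subcategory of `D(Mod A)` (closed under isomorphisms). -/
noncomputable def derivedYShift (P : DerivedCategory (ModuleCat.{u} A)) :
    ObjectProperty (DerivedCategory (ModuleCat.{u} A)) :=
  (classY P).map (DerivedCategory.singleFunctor (ModuleCat.{u} A) 0 ⋙
    shiftFunctor (DerivedCategory (ModuleCat.{u} A)) (1 : ℤ))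

/-- The `u`-small left modules over `B`. The morphisms of `DerivedCategory (ModuleCat.{u} A)` are
represented in an auxiliary universe `w` (which may be larger than `u`), and so are
`B = End(P)ᵒᵖ` and its modules in `ModuleCat.{w} B`; a `B`-module in the sense of the universe `u`
in which `Mod A` is formed is a `B`-module whose underlying type is in bijection with a type in
`u`. For `w = u` this is no condition. -/
def isSmallModule (B : Type w) [Ring B] : ObjectProperty (ModuleCat.{w} B) :=
  fun L ↦ Small.{u} L

/-- The functor `Hom(P, -)` from `𝒞(P) = D(Mod A)^0(P)` to left modules over `End(P)ᵒᵖ`, where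
`b • h` is the composite of `b : P ⟶ P` followed by `h : P ⟶ X`. -/
noncomputable def homFunctor (P : DerivedCategory (ModuleCat.{u} A)) :
    (homHeart P).FullSubcategory ⥤ ModuleCat.{w} (End P)ᵐᵒᵖ :=
  (homHeart P).ι ⋙ preadditiveCoyonedaObj P

end Modules

end TwoTermComplex

/-! Write P for the two-term complex. Because its terms are projective, P lies in D^{≤0} and is left
orthogonal to D^{≤-2}. Hence Hom(P, M[i]) = 0 for a module M unless i is 0 or 1, and 𝒳 and 𝒴 are the
vanishing loci of these two groups. An object orthogonal to every P[i] has cohomology modules in 𝒳 ∩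
𝒴 = 0, so it is zero (`IsTwoTerm.isZero_of_homVanishes`). P is compact because its terms are small.

The condition H^0(P) ∈ 𝒳 makes the trace of H^0(P) in a module M an 𝒳-submodule with quotient in 𝒴
(`IsTwoTerm.exists_torsion_sequence`), so (𝒳, 𝒴) is a torsion pair in Mod A. Tilting the standard
t-structure at this pair gives a t-structure whose two halves are `homLE P` and `homGE P`
(`exists_truncation`, `hom_eq_zero_of_homLE_of_homGE`). Its heart is 𝒞(P). Truncating cones of
morphisms between heart objects shows that the heart is admissible abelian. The standard truncation
H^{-1}(M)[1] ⟶ M ⟶ H^0(M) of a heart object is its torsion sequence.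

The same condition gives Hom(P, P[i]) = 0 for i > 0 (`homLE_self`). Thus P behaves like a compact
projective generator of the heart, although P itself need not lie in it. Covering by direct sums of
copies of P gives faithfulness and fullness of Hom(P, -), and truncating the cone of a free
presentation gives essential surjectivity. -/

namespace TwoTermComplex

/-! ### Compactness as finite support of morphisms into direct sums. -/

section FiniteSupport

variable {C : Type w'} [Category.{w} C] [Preadditive C]

/-- The projection of a direct sum onto a summand. -/
noncomputable def cofanProj {J : Type*} {X : J → C} {c : Cofan X} (hc : IsColimit c) (j : J) :
    c.pt ⟶ X j :=
  open Classical in Cofan.IsColimit.desc hc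
    (fun i ↦ if h : i = j then eqToHom (by rw [h]) else 0)

@[simp]
lemma inj_cofanProj_self {J : Type*} {X : J → C} {c : Cofan X} (hc : IsColimit c) (j : J) :
    c.inj j ≫ cofanProj hc j = 𝟙 _ := by
  simp [cofanProj, Cofan.IsColimit.fac]

lemma inj_cofanProj_of_ne {J : Type*} {X : J → C} {c : Cofan X} (hc : IsColimit c) {i j : J}
    (h : i ≠ j) : c.inj i ≫ cofanProj hc j = 0 := by
  simp [cofanProj, Cofan.IsColimit.fac, h]

/-- The idempotent endomorphism of a direct sum given by a finite set of indices. -/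
noncomputable def cofanIdem {J : Type*} {X : J → C} {c : Cofan X} (hc : IsColimit c)
    (F : Finset J) : c.pt ⟶ c.pt :=
  ∑ j ∈ F, cofanProj hc j ≫ c.inj j

lemma inj_cofanIdem {J : Type*} {X : J → C} {c : Cofan X} (hc : IsColimit c) {F : Finset J} {j : J}
    (h : j ∈ F) : c.inj j ≫ cofanIdem hc F = c.inj j := by
  rw [cofanIdem, Preadditive.comp_sum, Finset.sum_eq_single j]
  · rw [← Category.assoc, inj_cofanProj_self, Category.id_comp]
  · intro b _ hb
    rw [← Category.assoc, inj_cofanProj_of_ne hc hb.symm, zero_comp]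
  · exact fun h' ↦ (h' h).elim

lemma inj_cofanIdem_of_notMem {J : Type*} {X : J → C} {c : Cofan X} (hc : IsColimit c)
    {F : Finset J} {j : J} (h : j ∉ F) : c.inj j ≫ cofanIdem hc F = 0 := by
  rw [cofanIdem, Preadditive.comp_sum]
  refine Finset.sum_eq_zero fun b hb ↦ ?_
  rw [← Category.assoc, inj_cofanProj_of_ne hc (by rintro rfl; exact h hb), zero_comp]

lemma cofanIdem_comp_of_subset {J : Type*} {X : J → C} {c : Cofan X} (hc : IsColimit c)
    {F G : Finset J} (h : F ⊆ G) : cofanIdem hc F ≫ cofanIdem hc G = cofanIdem hc F := by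
  rw [cofanIdem, Preadditive.sum_comp]
  refine Finset.sum_congr rfl fun j hj ↦ ?_
  rw [Category.assoc, inj_cofanIdem hc (h hj)]

lemma cofanIdem_naturality {J : Type*} {X X' : J → C} {c : Cofan X} (hc : IsColimit c)
    {c' : Cofan X'} (hc' : IsColimit c') (φ : c.pt ⟶ c'.pt) (s : ∀ j, X j ⟶ X' j)
    (hφ : ∀ j, c.inj j ≫ φ = s j ≫ c'.inj j) (F : Finset J) :
    cofanIdem hc F ≫ φ = φ ≫ cofanIdem hc' F := by
  refine Cofan.IsColimit.hom_ext hc _ _ fun j ↦ ?_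
  rw [← Category.assoc, ← Category.assoc, hφ, Category.assoc (s j)]
  by_cases hj : j ∈ F
  · rw [inj_cofanIdem hc hj, inj_cofanIdem hc' hj, hφ]
  · rw [inj_cofanIdem_of_notMem hc hj, inj_cofanIdem_of_notMem hc' hj, zero_comp, comp_zero]

/-- Every morphism from `K` to a direct sum factors through a finite subsum. -/
def HasFiniteSupports (K : C) : Prop :=
  ∀ (J : Type u) (X : J → C) (c : Cofan X) (hc : IsColimit c) (f : K ⟶ c.pt),
    ∃ F : Finset J, f ≫ cofanIdem hc F = f

lemma comp_cofanIdem_of_subset {K : C} {J : Type*} {X : J → C} {c : Cofan X} (hc : IsColimit c)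
    {f : K ⟶ c.pt} {F G : Finset J} (h : F ⊆ G) (hf : f ≫ cofanIdem hc F = f) :
    f ≫ cofanIdem hc G = f := by
  rw [← hf, Category.assoc, cofanIdem_comp_of_subset hc h]

lemma comp_cofanProj_of_notMem {K : C} {J : Type*} {X : J → C} {c : Cofan X} (hc : IsColimit c)
    {f : K ⟶ c.pt} {F : Finset J} (hf : f ≫ cofanIdem hc F = f) {j : J} (hj : j ∉ F) :
    f ≫ cofanProj hc j = 0 := by
  rw [← hf, cofanIdem, Category.assoc, Preadditive.sum_comp, Finset.sum_eq_zero, comp_zero]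
  intro i hi
  rw [Category.assoc, inj_cofanProj_of_ne hc (by rintro rfl; exact hj hi), comp_zero]

/-- Projections detect morphisms out of K even when the direct sum does not embed in a product. -/
lemma HasFiniteSupports.eq_zero {K : C} (hK : HasFiniteSupports.{u} K) {J : Type u} {X : J → C}
    {c : Cofan X} (hc : IsColimit c) (f : K ⟶ c.pt) (hf : ∀ j, f ≫ cofanProj hc j = 0) :
    f = 0 := by
  obtain ⟨F, hF⟩ := hK J X c hc f
  rw [← hF, cofanIdem, Preadditive.comp_sum]
  exact Finset.sum_eq_zero fun j _ ↦ by rw [← Category.assoc, hf, zero_comp]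

/-- A morphism is the finite sum of its components, so a cocone on the groups Hom(K, X j) extends
uniquely by summing its values on these components. -/
lemma HasFiniteSupports.homCommutesWithDirectSums {K : C} (hK : HasFiniteSupports.{u} K) :
    HomCommutesWithDirectSums.{u} K := by
  intro J
  refine @preservesColimitsOfShape_of_discrete _ _ _ _ _ _ fun X ↦ ⟨fun {c} hc ↦ ⟨?_⟩⟩
  let c' : Cofan X := c
  have fin (f : K ⟶ c'.pt) : ∃ F : Finset J, ∀ j ∉ F, f ≫ cofanProj (c := c') hc j = 0 := by
    obtain ⟨F, hF⟩ := hK J X c' hc f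
    exact ⟨F, fun j hj ↦ comp_cofanProj_of_notMem hc hF hj⟩
  have finSupp (t : Cofan fun j ↦ (preadditiveCoyoneda.obj (Opposite.op K)).obj (X j))
      (f : K ⟶ c'.pt) :
      (Function.support fun j ↦ (t.inj j).hom (f ≫ cofanProj (c := c') hc j)).Finite := by
    obtain ⟨F, hF⟩ := fin f
    refine F.finite_toSet.subset fun j hj ↦ ?_
    by_contra h
    exact hj (by simp only [hF j h]; exact map_zero (t.inj j).hom)
  refine (Cofan.isColimitMapCoconeEquiv _ X c').symm (Cofan.IsColimit.mk _
    (fun t ↦ AddCommGrpCat.ofHom (AddMonoidHom.mk' (fun f : K ⟶ c'.pt ↦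
      ∑ᶠ j, (t.inj j).hom (f ≫ cofanProj (c := c') hc j)) ?_)) ?_ ?_)
  · intro f g
    rw [← finsum_add_distrib (finSupp t f) (finSupp t g)]
    refine finsum_congr fun j ↦ ?_
    exact (congrArg (t.inj j).hom (Preadditive.add_comp _ _ _ f g _)).trans
      (map_add (t.inj j).hom _ _)
  · intro t j
    ext (f : K ⟶ X j)
    refine (finsum_eq_single _ j fun i hi ↦ ?_).trans ?_
    · change (t.inj i).hom ((f ≫ c'.inj j) ≫ _) = 0
      rw [Category.assoc, inj_cofanProj_of_ne hc hi.symm, comp_zero]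
      exact map_zero (t.inj i).hom
    · change (t.inj j).hom ((f ≫ c'.inj j) ≫ _) = _
      rw [Category.assoc, inj_cofanProj_self, Category.comp_id]
  · intro t m hm
    ext (f : K ⟶ c'.pt)
    obtain ⟨F, hF⟩ := hK J X c' hc f
    have key (j : J) (g : K ⟶ X j) : m.hom (g ≫ c'.inj j) = (t.inj j).hom g := by
      rw [← hm j]; rfl
    change m.hom f = ∑ᶠ j, (t.inj j).hom (f ≫ cofanProj (c := c') hc j)
    rw [finsum_eq_sum_of_support_subset (s := F)]
    · conv_lhs => rw [← hF, cofanIdem, Preadditive.comp_sum]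
      refine (map_sum m.hom _ _).trans (Finset.sum_congr rfl fun j _ ↦ ?_)
      rw [← key, Category.assoc]
    · intro j hj
      by_contra h
      exact hj (by
        simp only [comp_cofanProj_of_notMem hc hF h]; exact map_zero (t.inj j).hom)

end FiniteSupport

/-- The images of the summands span: the quotient by their span receives the zero map from each
summand, so the quotient map vanishes. -/
lemma ModuleCat.sum_inj_cofanProj {R : Type*} [Ring R] {J : Type*} {X : J → ModuleCat.{u} R}
    {c : Cofan X} (hc : IsColimit c) (x : c.pt) :
    ∃ F : Finset J, (cofanIdem hc F).hom x = x := by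
  let S : Submodule R c.pt := ⨆ j, LinearMap.range (c.inj j).hom
  have hS : S = ⊤ := by
    have : ModuleCat.ofHom S.mkQ = 0 := by
      refine Cofan.IsColimit.hom_ext hc _ _ fun j ↦ ?_
      ext y
      simp only [comp_zero]
      exact (Submodule.Quotient.mk_eq_zero S).2
        (Submodule.mem_iSup_of_mem j (LinearMap.mem_range_self _ y))
    rw [← S.ker_mkQ, LinearMap.ker_eq_top]
    exact congrArg ModuleCat.Hom.hom this
  have hx : x ∈ S := hS ▸ Submodule.mem_top
  induction hx using Submodule.iSup_induction' with
  | mem j x hx =>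
    obtain ⟨y, rfl⟩ := hx
    exact ⟨{j}, congrArg (fun f ↦ f.hom y) (inj_cofanIdem hc (Finset.mem_singleton_self j))⟩
  | zero => exact ⟨∅, map_zero _⟩
  | add x y _ _ hx hy =>
    classical
    obtain ⟨F, hF⟩ := hx
    obtain ⟨G, hG⟩ := hy
    refine ⟨F ∪ G, ?_⟩
    rw [map_add, ← hF, ← hG, ← ModuleCat.comp_apply, ← ModuleCat.comp_apply,
      cofanIdem_comp_of_subset hc Finset.subset_union_left,
      cofanIdem_comp_of_subset hc Finset.subset_union_right, hF, hG]

/-- The spanning argument for modules, applied to Hom(K, c.pt) as the direct sum of the groups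
Hom(K, X j). -/
lemma HomCommutesWithDirectSums.hasFiniteSupports {C : Type w'} [Category.{u} C] [Preadditive C]
    {K : C} (hK : HomCommutesWithDirectSums.{u} K) : HasFiniteSupports.{u} K := by
  intro J X c hc f
  have := hK J
  have hc' := Cofan.isColimitMapCoconeEquiv _ X c
    (isColimitOfPreserves (preadditiveCoyoneda.obj (Opposite.op K)) hc)
  let S : AddSubgroup (K ⟶ c.pt) :=
    ⨆ j, AddMonoidHom.range ((preadditiveCoyoneda.obj (Opposite.op K)).map (c.inj j)).hom
  have hS : S = ⊤ := by
    have : AddCommGrpCat.ofHom (QuotientAddGroup.mk' S) = 0 := by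
      refine Cofan.IsColimit.hom_ext hc' _ _ fun j ↦ ?_
      ext y
      exact (QuotientAddGroup.eq_zero_iff _).2
        (AddSubgroup.mem_iSup_of_mem j ⟨y, rfl⟩)
    rw [← QuotientAddGroup.ker_mk' S, eq_top_iff]
    intro x _
    exact congrArg (fun g ↦ g.hom x) this
  have hf : f ∈ S := hS ▸ AddSubgroup.mem_top f
  induction hf using AddSubgroup.iSup_induction' with
  | hp j x hx =>
    obtain ⟨(y : K ⟶ X j), rfl⟩ := hx
    refine ⟨{j}, ?_⟩
    change (y ≫ c.inj j) ≫ _ = y ≫ c.inj j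
    rw [Category.assoc, inj_cofanIdem hc (Finset.mem_singleton_self j)]
  | h1 => exact ⟨∅, zero_comp⟩
  | hadd x y _ _ hx hy =>
    classical
    obtain ⟨F, hF⟩ := hx
    obtain ⟨G, hG⟩ := hy
    refine ⟨F ∪ G, ?_⟩
    rw [Preadditive.add_comp, comp_cofanIdem_of_subset hc Finset.subset_union_left hF,
      comp_cofanIdem_of_subset hc Finset.subset_union_right hG]

section Functoriality

variable {C : Type w'} [Category.{w} C] [Preadditive C]

lemma map_cofanProj {D : Type*} [Category* D] [Preadditive D] (G : C ⥤ D) [G.Additive]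
    {J : Type*} {X : J → C} {c : Cofan X} (hc : IsColimit c)
    (hc' : IsColimit (Cofan.mk (G.obj c.pt) fun j ↦ G.map (c.inj j) : Cofan fun j ↦ G.obj (X j)))
    (j : J) : G.map (cofanProj hc j) = cofanProj hc' j := by
  refine Cofan.IsColimit.hom_ext hc' _ _ fun i ↦ ?_
  by_cases h : i = j
  · subst h
    refine Eq.trans ?_ (inj_cofanProj_self hc' i).symm
    change G.map _ ≫ G.map _ = _
    rw [← G.map_comp, inj_cofanProj_self, G.map_id]
  · refine Eq.trans ?_ (inj_cofanProj_of_ne hc' h).symm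
    change G.map _ ≫ G.map _ = _
    rw [← G.map_comp, inj_cofanProj_of_ne hc h, G.map_zero]

lemma map_cofanIdem {D : Type*} [Category* D] [Preadditive D] (G : C ⥤ D) [G.Additive]
    {J : Type*} {X : J → C} {c : Cofan X} (hc : IsColimit c)
    (hc' : IsColimit (Cofan.mk (G.obj c.pt) fun j ↦ G.map (c.inj j) : Cofan fun j ↦ G.obj (X j)))
    (F : Finset J) : G.map (cofanIdem hc F) = cofanIdem hc' F := by
  simp only [cofanIdem, G.map_sum, G.map_comp, map_cofanProj G hc hc']
  rfl

lemma HasFiniteSupports.of_iso {K L : C} (e : K ≅ L) (hK : HasFiniteSupports.{u} K) :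
    HasFiniteSupports.{u} L := by
  intro J X c hc f
  obtain ⟨F, hF⟩ := hK J X c hc (e.hom ≫ f)
  exact ⟨F, by rwa [Category.assoc, cancel_epi] at hF⟩

end Functoriality

/-! ### Finite supports under shifts and cones. -/

section Triangulated

variable {T : Type w'} [Category.{w} T] [Preadditive T] [HasShift T ℤ]
  [∀ n : ℤ, (shiftFunctor T n).Additive]

lemma HasFiniteSupports.shift {K : T} (hK : HasFiniteSupports.{u} K) (n : ℤ) :
    HasFiniteSupports.{u} (K⟦n⟧) := by
  intro J X c hc f
  let G := shiftFunctor T (-n)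
  have hc' : IsColimit (Cofan.mk (G.obj c.pt) fun j ↦ G.map (c.inj j) :
      Cofan fun j ↦ G.obj (X j)) :=
    Cofan.isColimitMapCoconeEquiv _ X c (isColimitOfPreserves G hc)
  let e : (shiftFunctor T (-n)).obj (K⟦n⟧) ≅ K := (shiftEquiv T n).unitIso.symm.app K
  obtain ⟨F, hF⟩ := (hK.of_iso e.symm) J _ _ hc' (G.map f)
  refine ⟨F, G.map_injective ?_⟩
  rw [G.map_comp, map_cofanIdem G hc hc']
  exact hF

variable [HasZeroObject T] [Pretriangulated T]

section Exactness

variable {X Y Z : T} {f : X ⟶ Y} {g : Y ⟶ Z} {h : Z ⟶ X⟦(1 : ℤ)⟧}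
  (hT : Triangle.mk f g h ∈ distTriang T)

include hT

lemma distTriang_comp₁₂ : f ≫ g = 0 := comp_distTriang_mor_zero₁₂ _ hT

lemma distTriang_comp₂₃ : g ≫ h = 0 := comp_distTriang_mor_zero₂₃ _ hT

lemma distTriang_lift₁ {K : T} (k : K ⟶ Y) (hk : k ≫ g = 0) : ∃ l : K ⟶ X, k = l ≫ f :=
  Triangle.coyoneda_exact₂ _ hT k hk

lemma distTriang_lift₂ {K : T} (k : K ⟶ Z) (hk : k ≫ h = 0) : ∃ l : K ⟶ Y, k = l ≫ g :=
  Triangle.coyoneda_exact₃ _ hT k hk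

lemma distTriang_desc₃ {K : T} (k : Y ⟶ K) (hk : f ≫ k = 0) : ∃ l : Z ⟶ K, k = g ≫ l :=
  Triangle.yoneda_exact₂ _ hT k hk

lemma distTriang_desc₁ {K : T} (k : Z ⟶ K) (hk : g ≫ k = 0) :
    ∃ l : X⟦(1 : ℤ)⟧ ⟶ K, k = h ≫ l :=
  Triangle.yoneda_exact₃ _ hT k hk

lemma distTriang_lift₃ {K : T} (k : K ⟶ X⟦(1 : ℤ)⟧) (hk : k ≫ f⟦1⟧' = 0) :
    ∃ l : K ⟶ Z, k = l ≫ h :=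
  Triangle.coyoneda_exact₁ _ hT k hk

end Exactness

lemma HasFiniteSupports.of_distTriang (S : Triangle T) (hS : S ∈ distTriang T)
    (h₁ : HasFiniteSupports.{u} S.obj₁) (h₂ : HasFiniteSupports.{u} S.obj₂) :
    HasFiniteSupports.{u} S.obj₃ := by
  classical
  intro J X c hc f
  obtain ⟨F, hF⟩ := h₂ J X c hc (S.mor₂ ≫ f)
  -- Removing the finite part seen by the second vertex leaves a morphism that factors through the
  -- shifted first vertex, which has finite supports too.
  obtain ⟨g, hg⟩ := S.yoneda_exact₃ hS (f - f ≫ cofanIdem hc F) (by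
    rw [Preadditive.comp_sub, ← Category.assoc, hF, sub_self])
  obtain ⟨G, hG⟩ := h₁.shift 1 J X c hc g
  have h₁ : (f - f ≫ cofanIdem hc F) ≫ cofanIdem hc (F ∪ G) = f - f ≫ cofanIdem hc F := by
    rw [hg, Category.assoc, comp_cofanIdem_of_subset hc Finset.subset_union_right hG]
  refine ⟨F ∪ G, ?_⟩
  rwa [Preadditive.sub_comp, Category.assoc,
    cofanIdem_comp_of_subset hc Finset.subset_union_left, sub_left_inj] at h₁

end Triangulated


/-! ### Homology of direct sums of complexes. -/

section Complexes

variable {A : Type u} [Ring A] {J : Type u} {X X' : J → CochainComplex (ModuleCat.{u} A) ℤ}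
  {c : Cofan X} (hc : IsColimit c) {c' : Cofan X'} (hc' : IsColimit c')

/-- A representing cycle is supported on finitely many summands, and the idempotent fixing it as an
element fixes it as a cycle because cycles embed in the degree n term. -/
lemma exists_homologyMap_cofanIdem (n : ℤ) (x : c.pt.homology n) :
    ∃ F : Finset J, (HomologicalComplex.homologyMap (cofanIdem hc F) n).hom x = x := by
  obtain ⟨z, rfl⟩ := (ModuleCat.epi_iff_surjective (c.pt.homologyπ n)).1 inferInstance x
  have hn := Cofan.isColimitMapCoconeEquiv _ X c
    (isColimitOfPreserves (HomologicalComplex.eval (ModuleCat.{u} A) (ComplexShape.up ℤ) n) hc)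
  obtain ⟨F, hF⟩ := ModuleCat.sum_inj_cofanProj hn ((c.pt.iCycles n).hom z)
  rw [← map_cofanIdem _ hc hn] at hF
  have hz : (HomologicalComplex.cyclesMap (cofanIdem hc F) n).hom z = z := by
    apply (ModuleCat.mono_iff_injective (c.pt.iCycles n)).1 inferInstance
    refine (congrArg (fun f ↦ f.hom z)
      (HomologicalComplex.cyclesMap_i (cofanIdem hc F) n)).trans hF
  have nat : (HomologicalComplex.homologyMap (cofanIdem hc F) n).hom ((c.pt.homologyπ n).hom z) =
      (c.pt.homologyπ n).hom ((HomologicalComplex.cyclesMap (cofanIdem hc F) n).hom z) :=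
    congrArg (fun f ↦ f.hom z) (HomologicalComplex.homologyπ_naturality (cofanIdem hc F) n)
  exact ⟨F, nat.trans (congrArg (c.pt.homologyπ n).hom hz)⟩

lemma eq_sum_homologyMap (n : ℤ) (x : c.pt.homology n) :
    ∃ F : Finset J, x = ∑ j ∈ F, (HomologicalComplex.homologyMap (c.inj j) n).hom
      ((HomologicalComplex.homologyMap (cofanProj hc j) n).hom x) := by
  obtain ⟨F, hF⟩ := exists_homologyMap_cofanIdem hc n x
  refine ⟨F, hF.symm.trans ?_⟩
  have : HomologicalComplex.homologyMap (cofanIdem hc F) n =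
      ∑ j ∈ F, HomologicalComplex.homologyMap (cofanProj hc j) n ≫
        HomologicalComplex.homologyMap (c.inj j) n := by
    refine (Functor.map_sum (HomologicalComplex.homologyFunctor _ _ n) _ _).trans ?_
    exact Finset.sum_congr rfl fun j _ ↦ HomologicalComplex.homologyMap_comp _ _ _
  rw [this, ModuleCat.hom_sum, LinearMap.sum_apply]
  rfl

include hc in
lemma homology_hom_ext {n : ℤ} {M : ModuleCat.{u} A} {f g : c.pt.homology n ⟶ M}
    (h : ∀ j, HomologicalComplex.homologyMap (c.inj j) n ≫ f =
      HomologicalComplex.homologyMap (c.inj j) n ≫ g) : f = g := by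
  ext x
  obtain ⟨F, hF⟩ := eq_sum_homologyMap hc n x
  rw [hF, map_sum, map_sum]
  exact Finset.sum_congr rfl fun j _ ↦ congrArg (fun k ↦ k.hom ((HomologicalComplex.homologyMap
    (cofanProj hc j) n).hom x)) (h j)

include hc hc' in
lemma quasiIso_of_isColimit_cofan (φ : c.pt ⟶ c'.pt) (s : ∀ j, X j ⟶ X' j)
    (hφ : ∀ j, c.inj j ≫ φ = s j ≫ c'.inj j) (hs : ∀ j, QuasiIso (s j)) : QuasiIso φ := by
  have hφ' (j : J) : φ ≫ cofanProj hc' j = cofanProj hc j ≫ s j := by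
    refine Cofan.IsColimit.hom_ext hc _ _ fun i ↦ ?_
    rw [← Category.assoc, hφ, ← Category.assoc, Category.assoc]
    by_cases h : i = j
    · subst h
      rw [inj_cofanProj_self, inj_cofanProj_self, Category.comp_id, Category.id_comp]
    · rw [inj_cofanProj_of_ne hc h, inj_cofanProj_of_ne hc' h, comp_zero, zero_comp]
  have e (n : ℤ) (j : J) (x) : (HomologicalComplex.homologyMap φ n).hom
      ((HomologicalComplex.homologyMap (c.inj j) n).hom x) =
      (HomologicalComplex.homologyMap (c'.inj j) n).hom
        ((HomologicalComplex.homologyMap (s j) n).hom x) := by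
    have := congrArg (fun f ↦ HomologicalComplex.homologyMap f n) (hφ j)
    simp only [HomologicalComplex.homologyMap_comp] at this
    exact congrArg (fun f ↦ ModuleCat.Hom.hom f x) this
  have e' (n : ℤ) (j : J) (x) : (HomologicalComplex.homologyMap (cofanProj hc' j) n).hom
      ((HomologicalComplex.homologyMap φ n).hom x) = (HomologicalComplex.homologyMap (s j) n).hom
        ((HomologicalComplex.homologyMap (cofanProj hc j) n).hom x) := by
    have := congrArg (fun f ↦ HomologicalComplex.homologyMap f n) (hφ' j)
    simp only [HomologicalComplex.homologyMap_comp] at this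
    exact congrArg (fun f ↦ ModuleCat.Hom.hom f x) this
  have bij (n : ℤ) (j : J) :
      Function.Bijective (HomologicalComplex.homologyMap (s j) n).hom :=
    (ConcreteCategory.isIso_iff_bijective _).1 inferInstance
  refine ⟨fun n ↦ ?_⟩
  rw [quasiIsoAt_iff_isIso_homologyMap, ConcreteCategory.isIso_iff_bijective]
  constructor
  · refine (injective_iff_map_eq_zero (HomologicalComplex.homologyMap φ n).hom).2 fun x hx ↦ ?_
    obtain ⟨F, hF⟩ := eq_sum_homologyMap hc n x
    rw [hF]
    refine Finset.sum_eq_zero fun j _ ↦ ?_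
    have := e' n j x
    rw [hx, map_zero] at this
    rw [(injective_iff_map_eq_zero _).1 (bij n j).1 _ this.symm, map_zero]
  · intro y
    obtain ⟨F, hF⟩ := eq_sum_homologyMap hc' n y
    choose x hx using fun j ↦ (bij n j).2
      ((HomologicalComplex.homologyMap (cofanProj hc' j) n).hom y)
    refine ⟨∑ j ∈ F, (HomologicalComplex.homologyMap (c.inj j) n).hom (x j), ?_⟩
    change (HomologicalComplex.homologyMap φ n).hom _ = _
    refine Eq.trans ?_ hF.symm
    rw [map_sum]
    refine Finset.sum_congr rfl fun j _ ↦ ?_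
    rw [e, hx]

end Complexes

/-! ### Direct sums in the derived category and compactness of small projectives. -/

section Derived

variable {A : Type u} [Ring A] [HasDerivedCategory.{w} (ModuleCat.{u} A)]

open DerivedCategory

/-- Represent each component by a roof and add the roofs: a direct sum of quasi-isomorphisms is a
quasi-isomorphism. -/
lemma Q_cofan_exists_desc {J : Type u} {X : J → CochainComplex (ModuleCat.{u} A) ℤ}
    {c : Cofan X} (hc : IsColimit c) {Y : DerivedCategory (ModuleCat.{u} A)}
    (f : ∀ j, Q.obj (X j) ⟶ Y) : ∃ g : Q.obj c.pt ⟶ Y, ∀ j, Q.map (c.inj j) ≫ g = f j := by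
  obtain ⟨L, ⟨e⟩⟩ : ∃ L, Nonempty (Y ≅ Q.obj L) := ⟨_, ⟨(Q.objObjPreimageIso Y).symm⟩⟩
  choose X' s hs g hg using fun j ↦ right_fac (f j ≫ e.hom)
  have hs' (j : J) : QuasiIso (s j) := (isIso_Q_map_iff_quasiIso _ _).1 (hs j)
  let c' := Cofan.mk (∐ X') (Sigma.ι X')
  have hc' : IsColimit c' := coproductIsCoproduct X'
  let φ : c'.pt ⟶ c.pt := Cofan.IsColimit.desc hc' fun j ↦ s j ≫ c.inj j
  have hφ (j : J) : c'.inj j ≫ φ = s j ≫ c.inj j := Cofan.IsColimit.fac hc' _ j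
  have := quasiIso_of_isColimit_cofan hc' hc φ s hφ hs'
  let ψ : c'.pt ⟶ L := Cofan.IsColimit.desc hc' g
  have hψ (j : J) : c'.inj j ≫ ψ = g j := Cofan.IsColimit.fac hc' _ j
  refine ⟨inv (Q.map φ) ≫ Q.map ψ ≫ e.inv, fun j ↦ ?_⟩
  have : Q.map (c.inj j) ≫ inv (Q.map φ) = inv (Q.map (s j)) ≫ Q.map (c'.inj j) := by
    rw [IsIso.eq_inv_comp, ← Category.assoc, IsIso.comp_inv_eq, ← Q.map_comp, ← Q.map_comp, hφ]
  rw [← Category.assoc, this, Category.assoc, ← Category.assoc (Q.map (c'.inj j)), ← Q.map_comp,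
    hψ, ← Category.assoc, ← hg, Category.assoc, e.hom_inv_id, Category.comp_id]

/-- The injections lift to the fibre W of f and glue to b. It need not be known that `b ≫ w` is the
identity: it fixes every injection, hence is the identity on homology and so invertible, while its
composite with f is zero. -/
lemma Q_cofan_hom_ext {J : Type u} {X : J → CochainComplex (ModuleCat.{u} A) ℤ}
    {c : Cofan X} (hc : IsColimit c) {Y : DerivedCategory (ModuleCat.{u} A)}
    (f : Q.obj c.pt ⟶ Y) (hf : ∀ j, Q.map (c.inj j) ≫ f = 0) : f = 0 := by
  obtain ⟨W, w, δ, hT⟩ := distinguished_cocone_triangle₁ f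
  choose a ha using fun j ↦ distTriang_lift₁ hT (Q.map (c.inj j)) (hf j)
  obtain ⟨b, hb⟩ := Q_cofan_exists_desc hc a
  have h₁ (j : J) : Q.map (c.inj j) ≫ b ≫ w = Q.map (c.inj j) := by
    rw [← Category.assoc, hb]; exact (ha j).symm
  have : IsIso (b ≫ w) := by
    rw [isIso_iff]
    intro n
    have : (homologyFunctor (ModuleCat.{u} A) n).map (b ≫ w) = 𝟙 _ := by
      let e := homologyFunctorFactors (ModuleCat.{u} A) n
      rw [← cancel_epi (e.inv.app c.pt)]
      refine homology_hom_ext hc fun j ↦ ?_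
      have nat (g : Q.obj c.pt ⟶ Q.obj c.pt) : HomologicalComplex.homologyMap (c.inj j) n ≫
          e.inv.app c.pt ≫ (homologyFunctor (ModuleCat.{u} A) n).map g = e.inv.app (X j) ≫
            (homologyFunctor (ModuleCat.{u} A) n).map (Q.map (c.inj j) ≫ g) := by
        have := e.inv.naturality (c.inj j)
        rw [Functor.map_comp]
        exact (Category.assoc _ _ _).symm.trans ((congrArg (· ≫ _) this).trans
          (Category.assoc _ _ _))
      refine (nat (b ≫ w)).trans ?_
      rw [h₁, ← (homologyFunctor (ModuleCat.{u} A) n).map_id]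
      refine Eq.trans ?_ (nat (𝟙 _)).symm
      rw [Category.comp_id]
    rw [this]
    infer_instance
  rw [← cancel_epi (b ≫ w), comp_zero, Category.assoc]
  rw [distTriang_comp₁₂ hT, comp_zero]

/-- The localization functor to the derived category of a module category
commutes with direct sums. -/
noncomputable def isColimitQCofan {J : Type u} {X : J → CochainComplex (ModuleCat.{u} A) ℤ}
    {c : Cofan X} (hc : IsColimit c) :
    IsColimit (Cofan.mk (Q.obj c.pt) fun j ↦ Q.map (c.inj j) : Cofan fun j ↦ Q.obj (X j)) :=
  Cofan.IsColimit.mk _ (fun t ↦ (Q_cofan_exists_desc hc t.inj).choose)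
    (fun t ↦ (Q_cofan_exists_desc hc t.inj).choose_spec)
    (fun t m hm ↦ by
      rw [← sub_eq_zero]
      refine Q_cofan_hom_ext hc _ fun j ↦ ?_
      rw [Preadditive.comp_sub, (Q_cofan_exists_desc hc t.inj).choose_spec, sub_eq_zero]
      exact hm j)

/-- A direct sum in the derived category is represented by a direct sum of complexes. -/
lemma exists_iso_Q_cofan {J : Type u} {Y : J → DerivedCategory (ModuleCat.{u} A)} :
    ∃ (X : J → CochainComplex (ModuleCat.{u} A) ℤ) (e : ∀ j, Q.obj (X j) ≅ Y j),
      Nonempty (IsColimit (Cofan.mk (Q.obj (∐ X))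
        fun j ↦ (e j).inv ≫ Q.map (Sigma.ι X j) : Cofan Y)) := by
  refine ⟨fun j ↦ Q.objPreimage (Y j), fun j ↦ Q.objObjPreimageIso (Y j), ⟨?_⟩⟩
  have hc := isColimitQCofan (coproductIsCoproduct fun j ↦ Q.objPreimage (Y j))
  refine Cofan.IsColimit.mk _ (fun t ↦ Cofan.IsColimit.desc hc
    fun j ↦ (Q.objObjPreimageIso (Y j)).hom ≫ t.inj j) ?_ ?_
  · intro t j
    have := Cofan.IsColimit.fac hc (fun j ↦ (Q.objObjPreimageIso (Y j)).hom ≫ t.inj j) j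
    rw [cofan_mk_inj, Category.assoc, Iso.inv_comp_eq]
    exact this
  · intro t m hm
    refine Cofan.IsColimit.hom_ext hc _ _ fun j ↦ ?_
    have := Cofan.IsColimit.fac hc (fun j ↦ (Q.objObjPreimageIso (Y j)).hom ≫ t.inj j) j
    rw [this, ← hm j]
    exact (((Q.objObjPreimageIso (Y j)).hom_inv_id_assoc _).symm.trans
      (congrArg _ (Category.assoc _ _ _).symm))

instance : HasCoproducts.{u} (DerivedCategory (ModuleCat.{u} A)) :=
  hasCoproducts_of_colimit_cofans _
    (fun Y ↦ (exists_iso_Q_cofan (Y := Y)).choose_spec.choose_spec.some)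

lemma exists_Q_map_eq {K L : CochainComplex (ModuleCat.{u} A) ℤ} [K.IsKProjective]
    (f : Q.obj K ⟶ Q.obj L) : ∃ g : K ⟶ L, Q.map g = f := by
  obtain ⟨g, hg⟩ := (CochainComplex.IsKProjective.Qh_map_bijective K
    ((HomotopyCategory.quotient _ _).obj L)).2
      ((quotientCompQhIso _).hom.app K ≫ f ≫ (quotientCompQhIso _).inv.app L)
  obtain ⟨g, rfl⟩ := (HomotopyCategory.quotient _ _).map_surjective g
  refine ⟨g, ?_⟩
  rw [← cancel_epi ((quotientCompQhIso _).hom.app K), ← quotientCompQhIso_hom_naturality, hg]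
  simp

instance (M : ModuleCat.{u} A) [Projective M] (n : ℤ) :
    CochainComplex.IsKProjective
      ((HomologicalComplex.single (ModuleCat.{u} A) (ComplexShape.up ℤ) n).obj M) := by
  have (i : ℤ) : Projective
      (((HomologicalComplex.single (ModuleCat.{u} A) (ComplexShape.up ℤ) n).obj M).X i) := by
    by_cases h : i = n
    · subst h
      exact Projective.of_iso (HomologicalComplex.singleObjXSelf _ i M).symm inferInstance
    · exact Projective.of_iso (HomologicalComplex.isZero_single_obj_X _ _ _ _ h).isoZero.symm
        inferInstance
  exact CochainComplex.isKProjective_of_projective _ n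

/-- K-projectivity turns the morphism into a chain map, which is determined by its component in
degree 0; smallness of M applies there. -/
lemma hasFiniteSupports_singleFunctor {M : ModuleCat.{u} A} [Projective M]
    (hM : HasFiniteSupports.{u} M) :
    HasFiniteSupports.{u} ((singleFunctor (ModuleCat.{u} A) 0).obj M) := by
  intro J Y c hc f
  obtain ⟨X, e, ⟨hX⟩⟩ := exists_iso_Q_cofan (Y := Y)
  obtain ⟨c₀, ⟨hc₀⟩, hX'⟩ : ∃ (c₀ : Cofan X) (_ : Nonempty (IsColimit c₀)),
      Nonempty (IsColimit (Cofan.mk (Q.obj c₀.pt) fun j ↦ (e j).inv ≫ Q.map (c₀.inj j) :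
        Cofan Y)) :=
    ⟨Cofan.mk _ (Sigma.ι X), ⟨coproductIsCoproduct X⟩, ⟨hX⟩⟩
  let φ : c.pt ≅ Q.obj c₀.pt := hc.coconePointUniqueUpToIso hX'.some
  have hφ (j : J) : c.inj j ≫ φ.hom = (e j).inv ≫ Q.map (c₀.inj j) :=
    hc.comp_coconePointUniqueUpToIso_hom hX'.some ⟨j⟩
  obtain ⟨f', hf'⟩ : ∃ f' : Q.obj
      ((HomologicalComplex.single _ (ComplexShape.up ℤ) 0).obj M) ⟶ Q.obj c₀.pt,
      f' = f ≫ φ.hom := ⟨_, rfl⟩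
  obtain ⟨g, rfl⟩ := exists_Q_map_eq f'
  have h₀ := Cofan.isColimitMapCoconeEquiv _ X _
    (isColimitOfPreserves (HomologicalComplex.eval (ModuleCat.{u} A) (ComplexShape.up ℤ) 0) hc₀)
  obtain ⟨F, hF⟩ := hM.of_iso (HomologicalComplex.singleObjXSelf _ 0 M).symm J _ _ h₀ (g.f 0)
  rw [← map_cofanIdem _ hc₀ h₀] at hF
  have hg' : g ≫ cofanIdem hc₀ F = g := HomologicalComplex.from_single_hom_ext hF
  refine ⟨F, ?_⟩
  have key : cofanIdem hc F ≫ φ.hom = φ.hom ≫ Q.map (cofanIdem hc₀ F) := by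
    rw [map_cofanIdem Q hc₀ (isColimitQCofan hc₀)]
    exact cofanIdem_naturality hc (isColimitQCofan hc₀) φ.hom (fun j ↦ (e j).inv) hφ F
  rw [← cancel_mono φ.hom, Category.assoc, key, ← Category.assoc]
  refine (congrArg (· ≫ _) hf'.symm).trans (Eq.trans ?_ hf')
  exact (Q.map_comp _ _).symm.trans (congrArg Q.map hg')

end Derived


/-! ### Vanishing of Hom(P, X[i]) along triangles. -/

section Vanishing

variable {T : Type w'} [Category.{w} T] [Preadditive T] [HasShift T ℤ]

/-- All morphisms from `P` to `X⟦i⟧` vanish. -/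
def HomVanishes (P X : T) (i : ℤ) : Prop := ∀ f : P ⟶ X⟦i⟧, f = 0

lemma homVanishes_of_hom_eq_zero {P X Y : T} {i : ℤ} (e : X⟦i⟧ ≅ Y) (h : ∀ f : P ⟶ Y, f = 0) :
    HomVanishes P X i := fun f ↦ by
  rw [← cancel_mono e.hom, zero_comp]
  exact h _

lemma HomVanishes.hom_eq_zero {P X Y : T} {i : ℤ} (h : HomVanishes P X i) (e : X⟦i⟧ ≅ Y)
    (f : P ⟶ Y) : f = 0 := by
  rw [← cancel_mono e.inv, zero_comp]
  exact h _

lemma HomVanishes.of_iso {P X Y : T} {i : ℤ} (h : HomVanishes P X i) (e : X ≅ Y) :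
    HomVanishes P Y i :=
  homVanishes_of_hom_eq_zero ((shiftFunctor T i).mapIso e.symm) h

lemma homVanishes_zero_iff {P X : T} : HomVanishes P X 0 ↔ ∀ f : P ⟶ X, f = 0 :=
  ⟨fun h f ↦ h.hom_eq_zero ((shiftFunctorZero T ℤ).app X) f,
    fun h ↦ homVanishes_of_hom_eq_zero ((shiftFunctorZero T ℤ).app X) h⟩

lemma homVanishes_shift_iff {P X : T} (a i j : ℤ) (h : a + i = j) :
    HomVanishes P (X⟦a⟧) i ↔ HomVanishes P X j :=
  ⟨fun h' ↦ homVanishes_of_hom_eq_zero ((shiftFunctorAdd' T a i j h).app X) h',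
    fun h' ↦ homVanishes_of_hom_eq_zero ((shiftFunctorAdd' T a i j h).symm.app X) h'⟩

variable [∀ n : ℤ, (shiftFunctor T n).Additive]

lemma homVanishes_of_isZero {P X : T} (hX : IsZero X) (i : ℤ) : HomVanishes P X i :=
  fun _ ↦ ((shiftFunctor T i).map_isZero hX).eq_of_tgt _ _

variable [HasZeroObject T] [Pretriangulated T]

/-- The long exact sequence of Hom(P, -), used throughout for degree bookkeeping; rotation gives the
two outer positions. -/
lemma HomVanishes.mid {S : Triangle T} (hS : S ∈ distTriang T) {P : T} {i : ℤ}
    (h₁ : HomVanishes P S.obj₁ i) (h₃ : HomVanishes P S.obj₃ i) : HomVanishes P S.obj₂ i := by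
  intro f
  obtain ⟨g, rfl⟩ := Triangle.coyoneda_exact₂ _ (Triangle.shift_distinguished _ hS i) f (h₃ _)
  rw [h₁ g]
  exact zero_comp

variable {X Y Z : T} {f : X ⟶ Y} {g : Y ⟶ Z} {h : Z ⟶ X⟦(1 : ℤ)⟧} {P : T}

lemma homVanishes₂ (hT : Triangle.mk f g h ∈ distTriang T) {i : ℤ}
    (h₁ : HomVanishes P X i) (h₃ : HomVanishes P Z i) : HomVanishes P Y i :=
  HomVanishes.mid hT h₁ h₃

lemma homVanishes₃ (hT : Triangle.mk f g h ∈ distTriang T) {i j : ℤ}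
    (h₂ : HomVanishes P Y i) (h₁ : HomVanishes P X j) (hij : i + 1 = j := by lia) :
    HomVanishes P Z i :=
  HomVanishes.mid (rot_of_distTriang _ hT) h₂
    ((homVanishes_shift_iff 1 i j (by lia)).2 h₁)

lemma homVanishes₁ (hT : Triangle.mk f g h ∈ distTriang T) {i j : ℤ}
    (h₂ : HomVanishes P Y i) (h₃ : HomVanishes P Z j) (hij : j + 1 = i := by lia) :
    HomVanishes P X i :=
  HomVanishes.mid (inv_rot_of_distTriang _ hT)
    ((homVanishes_shift_iff (-1) i j (by lia)).2 h₃) h₂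

end Vanishing

/-! ### Two-term objects against the standard t-structure; generation. -/

section Derived

open DerivedCategory DerivedCategory.TStructure

variable {A : Type u} [Ring A] [HasDerivedCategory.{w} (ModuleCat.{u} A)]

/-- The object `P` has the homological properties of a complex
of projectives concentrated in degrees `-1` and `0`. -/
structure IsTwoTerm (P : DerivedCategory (ModuleCat.{u} A)) : Prop where
  isLE : P.IsLE 0
  eq_zero : ∀ (X : DerivedCategory (ModuleCat.{u} A)), X.IsLE (-2) → ∀ f : P ⟶ X, f = 0

lemma hom_singleFunctor_eq_zero (M : ModuleCat.{u} A) [Projective M]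
    (X : DerivedCategory (ModuleCat.{u} A)) [X.IsLE (-1)]
    (f : (singleFunctor (ModuleCat.{u} A) 0).obj M ⟶ X) : f = 0 := by
  obtain ⟨K, hK, ⟨e⟩⟩ := X.exists_iso_Q_obj_of_isLE (-1)
  obtain ⟨f', hf'⟩ : ∃ f' : Q.obj
      ((HomologicalComplex.single _ (ComplexShape.up ℤ) 0).obj M) ⟶ Q.obj K,
      f' = f ≫ e.hom := ⟨_, rfl⟩
  obtain ⟨g, rfl⟩ := exists_Q_map_eq f'
  have : g = 0 := HomologicalComplex.from_single_hom_ext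
    ((K.isZero_of_isStrictlyLE (-1) 0 (by lia)).eq_of_tgt _ _)
  rw [← cancel_mono e.hom, ← hf', this, Functor.map_zero]
  exact zero_comp.symm

lemma dCone_distTriang {P₁ P₀ : ModuleCat.{u} A} (d : P₁ ⟶ P₀) :
    ∃ (g : (singleFunctor (ModuleCat.{u} A) 0).obj P₀ ⟶ dCone d)
      (h : dCone d ⟶ ((singleFunctor (ModuleCat.{u} A) 0).obj P₁)⟦(1 : ℤ)⟧),
      Triangle.mk ((singleFunctor (ModuleCat.{u} A) 0).map d) g h ∈
        distTriang (DerivedCategory (ModuleCat.{u} A)) :=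
  ⟨_, _, mappingCone_triangle_distinguished
    ((CochainComplex.singleFunctor (ModuleCat.{u} A) 0).map d)⟩

/-- The cone is an extension of P₁[1] by P₀. A morphism to D^{≤-2} dies on P₀, hence comes from
P₁[1], and desuspending puts its target in D^{≤-1}, where P₁ sees nothing. -/
lemma isTwoTerm_dCone {P₁ P₀ : ModuleCat.{u} A} [Projective P₁] [Projective P₀] (d : P₁ ⟶ P₀) :
    IsTwoTerm (dCone d) := by
  obtain ⟨g, h, hT⟩ := dCone_distTriang d
  constructor
  · refine t.isLE₂ _ (rot_of_distTriang _ hT) 0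
      (inferInstanceAs (IsLE ((singleFunctor (ModuleCat.{u} A) 0).obj P₀) 0)) ?_
    have := t.isLE_shift ((singleFunctor (ModuleCat.{u} A) 0).obj P₁) 0 1 (-1)
    exact t.isLE_of_le (((singleFunctor (ModuleCat.{u} A) 0).obj P₁)⟦(1 : ℤ)⟧) (-1) 0
  · intro X hX f
    have : X.IsLE (-1) := t.isLE_of_le _ (-2) (-1)
    obtain ⟨k, rfl⟩ := distTriang_desc₁ hT f (hom_singleFunctor_eq_zero _ _ _)
    have : k = 0 := by
      have : IsLE (X⟦(-1 : ℤ)⟧) (-1) := t.isLE_shift X (-2) (-1) (-1)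
      have e := (shiftFunctorCompIsoId (DerivedCategory (ModuleCat.{u} A)) 1 (-1) (by lia)).app
        ((singleFunctor (ModuleCat.{u} A) 0).obj P₁)
      apply (shiftFunctor _ (-1 : ℤ)).map_injective
      rw [Functor.map_zero, ← cancel_epi e.inv, comp_zero]
      exact hom_singleFunctor_eq_zero _ _ _
    rw [this, comp_zero]

lemma hasFiniteSupports_dCone {P₁ P₀ : ModuleCat.{u} A} [Projective P₁] [Projective P₀]
    (h₁ : HomCommutesWithDirectSums.{u} P₁) (h₀ : HomCommutesWithDirectSums.{u} P₀)
    (d : P₁ ⟶ P₀) : HasFiniteSupports.{u} (dCone d) := by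
  obtain ⟨g, h, hT⟩ := dCone_distTriang d
  exact HasFiniteSupports.of_distTriang _ hT
    (hasFiniteSupports_singleFunctor h₁.hasFiniteSupports)
    (hasFiniteSupports_singleFunctor h₀.hasFiniteSupports)

/-- An object with cohomology in a single degree is a shifted module. -/
lemma exists_iso_singleFunctor_shift (X : DerivedCategory (ModuleCat.{u} A)) (n : ℤ)
    (h₁ : X.IsLE n) (h₂ : X.IsGE n) :
    ∃ M : ModuleCat.{u} A, Nonempty (X⟦n⟧ ≅ (singleFunctor (ModuleCat.{u} A) 0).obj M) := by
  have : IsLE (X⟦n⟧) 0 := t.isLE_shift X n n 0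
  have : IsGE (X⟦n⟧) 0 := t.isGE_shift X n n 0
  exact exists_iso_singleFunctor_obj_of_isGE_of_isLE (X⟦n⟧) 0

lemma classX_iff {P : DerivedCategory (ModuleCat.{u} A)} {M : ModuleCat.{u} A} :
    classX P M ↔ HomVanishes P ((singleFunctor (ModuleCat.{u} A) 0).obj M) 1 := Iff.rfl

lemma classY_iff {P : DerivedCategory (ModuleCat.{u} A)} {M : ModuleCat.{u} A} :
    classY P M ↔ HomVanishes P ((singleFunctor (ModuleCat.{u} A) 0).obj M) 0 :=
  homVanishes_zero_iff.symm

lemma isZero_of_isGE_of_isLE {P X : DerivedCategory (ModuleCat.{u} A)} 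
    (hXY : ∀ M : ModuleCat.{u} A, classX P M → classY P M → IsZero M) (n : ℤ) (hn : X.IsLE n)
    (hn' : X.IsGE n) (hX : ∀ i, HomVanishes P X i) : IsZero X := by
  obtain ⟨M, ⟨e⟩⟩ := exists_iso_singleFunctor_shift X n hn hn'
  have hM (i : ℤ) : HomVanishes P ((singleFunctor (ModuleCat.{u} A) 0).obj M) i :=
    ((homVanishes_shift_iff n i (n + i) rfl).2 (hX _)).of_iso e
  have h₀ := hXY M (hM 1) (classY_iff.2 (hM 0))
  have h₁ : IsZero (X⟦n⟧) := (Functor.map_isZero (singleFunctor (ModuleCat.{u} A) 0) h₀).of_iso e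
  exact (Functor.map_isZero (shiftFunctor _ (-n)) h₁).of_iso
    ((shiftFunctorCompIsoId _ n (-n) (by lia)).symm.app X)

namespace IsTwoTerm

variable {P : DerivedCategory (ModuleCat.{u} A)} (hP : IsTwoTerm P)

include hP

lemma homVanishes_of_isLE {X : DerivedCategory (ModuleCat.{u} A)} {n : ℤ} (hX : X.IsLE n)
    (i : ℤ) (hi : n + 2 ≤ i) : HomVanishes P X i := by
  have : IsLE (X⟦i⟧) (n - i) := t.isLE_shift X n i (n - i)
  exact hP.eq_zero _ (t.isLE_of_le _ (n - i) (-2))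

lemma homVanishes_of_isGE {X : DerivedCategory (ModuleCat.{u} A)} {n : ℤ} (hX : X.IsGE n)
    (i : ℤ) (hi : i < n) : HomVanishes P X i := by
  intro f
  have : IsGE (X⟦i⟧) (n - i) := t.isGE_shift X n i (n - i)
  have := hP.isLE
  exact t.zero f 0 (n - i)

lemma homVanishes_singleFunctor (M : ModuleCat.{u} A) (i : ℤ) (h₀ : i ≠ 0) (h₁ : i ≠ 1) :
    HomVanishes P ((singleFunctor (ModuleCat.{u} A) 0).obj M) i := by
  by_cases h : i < 0
  · exact hP.homVanishes_of_isGE (n := 0) inferInstance i h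
  · exact hP.homVanishes_of_isLE (n := 0) inferInstance i (by lia)

variable (hXY : ∀ M : ModuleCat.{u} A, classX P M → classY P M → IsZero M)

include hXY

/-- Orthogonality to all P[i] passes to V = τ^{≥n} X and then to W = τ^{≤n} V: in each degree either
the two-term bound applies, or both neighbours in the long exact sequence vanish. So the degree n
cohomology is zero for every n. -/
lemma isZero_of_homVanishes {X : DerivedCategory (ModuleCat.{u} A)}
    (hX : ∀ i, HomVanishes P X i) : IsZero X := by
  have key (n : ℤ) : IsZero ((homologyFunctor (ModuleCat.{u} A) n).obj X) := by
    obtain ⟨U, V, hU, hV, a, b, c, hT⟩ := t.exists_triangle X (n - 1) n (by lia)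
    have hU : U.IsLE (n - 1) := ⟨hU⟩
    have hV : V.IsGE n := ⟨hV⟩
    have hV' (i : ℤ) : HomVanishes P V i := by
      by_cases hi : i < n
      · exact hP.homVanishes_of_isGE hV i hi
      · exact homVanishes₃ hT (hX i) (hP.homVanishes_of_isLE hU (i + 1) (by lia))
    obtain ⟨W, V', hW, hV'', a', b', c', hT'⟩ := t.exists_triangle V n (n + 1) rfl
    have hW : W.IsLE n := ⟨hW⟩
    have hV'' : V'.IsGE (n + 1) := ⟨hV''⟩
    have hW' (i : ℤ) : HomVanishes P W i := by
      by_cases hi : n + 2 ≤ i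
      · exact hP.homVanishes_of_isLE hW i hi
      · exact homVanishes₁ hT' (hV' i) (hP.homVanishes_of_isGE hV'' (i - 1) (by lia))
    have hWGE : W.IsGE n := by
      refine t.isGE₂ _ (inv_rot_of_distTriang _ hT') n ?_ hV
      have := t.isGE_shift V' (n + 1) (-1) (n + 2)
      exact t.isGE_of_ge (V'⟦(-1 : ℤ)⟧) n (n + 2)
    have hW₀ := isZero_of_isGE_of_isLE hXY n hW hWGE hW'
    have ex := HomologySequence.exact₂ _ hT n
    have ex' := HomologySequence.exact₂ _ hT' n
    have h₁ : IsZero ((homologyFunctor (ModuleCat.{u} A) n).obj V) :=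
      ex'.isZero_of_both_zeros ((Functor.map_isZero _ hW₀).eq_of_src _ _)
        ((isZero_of_isGE V' (n + 1) n (by lia)).eq_of_tgt _ _)
    exact ex.isZero_of_both_zeros ((isZero_of_isLE U (n - 1) n (by lia)).eq_of_src _ _)
      (h₁.eq_of_tgt _ _)
  obtain ⟨Z, hZ⟩ := HasZeroObject.zero (C := DerivedCategory (ModuleCat.{u} A))
  have : IsIso (0 : X ⟶ Z) := by
    rw [isIso_iff]
    intro n
    exact isIso_of_source_target_iso_zero _ (key n).isoZero
      (Functor.map_isZero _ hZ).isoZero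
  exact hZ.of_iso (asIso (0 : X ⟶ Z))

/-- The truncation τ^{≤-2} X is orthogonal to all P[i], hence zero. The bound drops by one because P
has a term in degree -1. -/
lemma isGE_of_homGE {X : DerivedCategory (ModuleCat.{u} A)} (hX : homGE P 0 X) : X.IsGE (-1) := by
  obtain ⟨U, V, hU, hV, a, b, c, hT⟩ := t.exists_triangle X (-2) (-1) (by lia)
  have hU : U.IsLE (-2) := ⟨hU⟩
  have hV : V.IsGE (-1) := ⟨hV⟩
  have hU₀ : IsZero U := hP.isZero_of_homVanishes hXY fun i ↦ by
    by_cases hi : i < 0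
    · exact homVanishes₁ hT (hX i hi) (hP.homVanishes_of_isGE hV (i - 1) (by lia))
    · exact hP.homVanishes_of_isLE hU i (by lia)
  have : IsIso b := (Triangle.isZero₁_iff_isIso₂ _ hT).1 hU₀
  exact t.isGE_of_iso (asIso b).symm (-1)

lemma isLE_of_homLE {X : DerivedCategory (ModuleCat.{u} A)} (hX : homLE P 0 X) : X.IsLE 0 := by
  obtain ⟨U, V, hU, hV, a, b, c, hT⟩ := t.exists_triangle X 0 1 (by lia)
  have hU : U.IsLE 0 := ⟨hU⟩
  have hV : V.IsGE 1 := ⟨hV⟩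
  have hV₀ : IsZero V := hP.isZero_of_homVanishes hXY fun i ↦ by
    by_cases hi : i < 1
    · exact hP.homVanishes_of_isGE hV i hi
    · exact homVanishes₃ hT (hX i (by lia)) (hP.homVanishes_of_isLE hU (i + 1) (by lia))
  have : IsIso a := (Triangle.isZero₃_iff_isIso₁ _ hT).1 hV₀
  exact t.isLE_of_iso (asIso a) 0

lemma isGeneratingSet_shifts (hc : HasFiniteSupports.{u} P) :
    IsGeneratingSet.{u} (shifts P) where
  compact := by
    rintro K ⟨i, ⟨e⟩⟩
    exact ((hc.shift i).of_iso e.symm).homCommutesWithDirectSums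
  stable := by
    rintro K n ⟨i, ⟨e⟩⟩
    exact ⟨i + n, ⟨(shiftFunctor _ n).mapIso e ≪≫ (shiftFunctorAdd _ i n).symm.app P⟩⟩
  isZero X hX := hP.isZero_of_homVanishes hXY fun i f ↦ by
    have e := (shiftFunctorCompIsoId (DerivedCategory (ModuleCat.{u} A)) i (-i) (by lia)).app X
    apply (shiftFunctor _ (-i)).map_injective
    rw [Functor.map_zero, ← cancel_mono e.hom, zero_comp]
    exact hX _ ⟨-i, ⟨Iso.refl _⟩⟩ _

end IsTwoTerm

end Derived


/-! ### Fibres of composites. -/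

section Triangles

variable {T : Type w'} [Category.{w} T] [Preadditive T] [HasZeroObject T] [HasShift T ℤ]
  [∀ n : ℤ, (shiftFunctor T n).Additive] [Pretriangulated T]

lemma distTriang_of_iso₃ {X Y Z Z' : T} {f : X ⟶ Y} {g : Y ⟶ Z} {h : Z ⟶ X⟦(1 : ℤ)⟧}
    (hT : Triangle.mk f g h ∈ distTriang T) (e : Z ≅ Z') :
    Triangle.mk f (g ≫ e.hom) (e.inv ≫ h) ∈ distTriang T := by
  refine isomorphic_distinguished _ hT _ ?_
  refine Triangle.isoMk _ _ (Iso.refl _) (Iso.refl _) e.symm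
    ((Category.comp_id f).trans (Category.id_comp f).symm) ?_ ?_
  · change (g ≫ e.hom) ≫ e.inv = 𝟙 Y ≫ g
    simp
  · change (e.inv ≫ h) ≫ (𝟙 X)⟦1⟧' = e.inv ≫ h
    simp

/-- If `Z₁ ⟶ Y` has fibre `Z₃` and `Y ⟶ W` has fibre `X`, then the fibre of the composition
is an extension of `X` by `Z₃`. -/
lemma exists_fiber_comp [IsTriangulated T] {Z₃ Z₁ Y X W : T} {a : Z₃ ⟶ Z₁} {b : Z₁ ⟶ Y}
    {c : Y ⟶ Z₃⟦(1 : ℤ)⟧} (h₁ : Triangle.mk a b c ∈ distTriang T) {i : X ⟶ Y} {p : Y ⟶ W}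
    {δ : W ⟶ X⟦(1 : ℤ)⟧} (h₂ : Triangle.mk i p δ ∈ distTriang T) :
    ∃ (U : T) (x : U ⟶ Z₁) (y : W ⟶ U⟦(1 : ℤ)⟧) (_ : Triangle.mk x (b ≫ p) y ∈ distTriang T)
      (m : Z₃⟦(1 : ℤ)⟧ ⟶ U⟦(1 : ℤ)⟧) (m' : U⟦(1 : ℤ)⟧ ⟶ X⟦(1 : ℤ)⟧)
      (δ' : X⟦(1 : ℤ)⟧ ⟶ Z₃⟦(1 : ℤ)⟧⟦(1 : ℤ)⟧), Triangle.mk m m' δ' ∈ distTriang T := by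
  obtain ⟨U, x, y, h₃⟩ := distinguished_cocone_triangle₁ (b ≫ p)
  have h₁' : Triangle.mk b c (-a⟦1⟧') ∈ distTriang T := rot_of_distTriang _ h₁
  have h₂' : Triangle.mk p δ (-i⟦1⟧') ∈ distTriang T := rot_of_distTriang _ h₂
  have h₃' : Triangle.mk (b ≫ p) y (-x⟦1⟧') ∈ distTriang T := rot_of_distTriang _ h₃
  let H := Triangulated.someOctahedron rfl h₁' h₂' h₃'
  exact ⟨U, x, y, h₃, H.m₁, H.m₃, _, H.mem⟩

end Triangles

/-! ### The torsion pair in Mod A and the tilted t-structure. -/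

section Derived

open DerivedCategory DerivedCategory.TStructure

variable {A : Type u} [Ring A] [HasDerivedCategory.{w} (ModuleCat.{u} A)]

lemma exists_distTriang_of_shortExact {X Y Z : ModuleCat.{u} A} (f : X ⟶ Y) (g : Y ⟶ Z)
    (w : f ≫ g = 0) (h : (ShortComplex.mk f g w).ShortExact) :
    ∃ δ : (singleFunctor (ModuleCat.{u} A) 0).obj Z ⟶ ((singleFunctor (ModuleCat.{u} A) 0).obj X)⟦(1 : ℤ)⟧,
      Triangle.mk ((singleFunctor (ModuleCat.{u} A) 0).map f) ((singleFunctor (ModuleCat.{u} A) 0).map g) δ ∈ distTriang (DerivedCategory (ModuleCat.{u} A)) :=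
  ⟨_, h.singleTriangle_distinguished⟩

lemma exists_distTriang_of_epi {Y Z : ModuleCat.{u} A} (g : Y ⟶ Z) [Epi g] :
    ∃ (X : ModuleCat.{u} A) (f : X ⟶ Y) (δ : (singleFunctor (ModuleCat.{u} A) 0).obj Z ⟶ ((singleFunctor (ModuleCat.{u} A) 0).obj X)⟦(1 : ℤ)⟧),
      Triangle.mk ((singleFunctor (ModuleCat.{u} A) 0).map f) ((singleFunctor (ModuleCat.{u} A) 0).map g) δ ∈ distTriang (DerivedCategory (ModuleCat.{u} A)) :=
  ⟨kernel g, kernel.ι g, exists_distTriang_of_shortExact _ _ (kernel.condition g)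
    ⟨ShortComplex.exact_of_f_is_kernel _ (kernelIsKernel g)⟩⟩

lemma exists_distTriang_of_mono {X Y : ModuleCat.{u} A} (f : X ⟶ Y) [Mono f] :
    ∃ δ : (singleFunctor (ModuleCat.{u} A) 0).obj (cokernel f) ⟶ ((singleFunctor (ModuleCat.{u} A) 0).obj X)⟦(1 : ℤ)⟧,
      Triangle.mk ((singleFunctor (ModuleCat.{u} A) 0).map f) ((singleFunctor (ModuleCat.{u} A) 0).map (cokernel.π f)) δ ∈
        distTriang (DerivedCategory (ModuleCat.{u} A)) :=
  exists_distTriang_of_shortExact _ _ (cokernel.condition f)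
    ⟨ShortComplex.exact_of_g_is_cokernel _ (cokernelIsCokernel f)⟩

variable {P : DerivedCategory (ModuleCat.{u} A)}

lemma classX_of_iso {M N : ModuleCat.{u} A} (e : M ≅ N) (h : classX P M) : classX P N :=
  HomVanishes.of_iso (P := P) (i := 1) h ((singleFunctor (ModuleCat.{u} A) 0).mapIso e)

/-- The morphism `p` is the truncation of `P` to degrees `≥ 0`; in particular it is universal
among morphisms from `P` to modules. -/
structure IsTopModule (P : DerivedCategory (ModuleCat.{u} A)) {N : ModuleCat.{u} A}
    (p : P ⟶ (singleFunctor (ModuleCat.{u} A) 0).obj N) : Prop where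
  exists_fac : ∀ (M : ModuleCat.{u} A) (f : P ⟶ (singleFunctor (ModuleCat.{u} A) 0).obj M), ∃ g : N ⟶ M, p ≫ (singleFunctor (ModuleCat.{u} A) 0).map g = f
  exists_fiber : ∃ (U : DerivedCategory (ModuleCat.{u} A)) (a : U ⟶ P)
    (c : (singleFunctor (ModuleCat.{u} A) 0).obj N ⟶ U⟦(1 : ℤ)⟧),
    U.IsLE (-1) ∧ Triangle.mk a p c ∈ distTriang (DerivedCategory (ModuleCat.{u} A))

lemma exists_isTopModule_dCone {P₁ P₀ : ModuleCat.{u} A} [Projective P₁] [Projective P₀]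
    (d : P₁ ⟶ P₀) : ∃ (N : ModuleCat.{u} A) (p : dCone d ⟶ (singleFunctor (ModuleCat.{u} A) 0).obj N),
      IsTopModule (dCone d) p ∧ Nonempty ((cone d).homology 0 ≅ N) := by
  have hP := isTwoTerm_dCone d
  obtain ⟨U, V, hU, hV, a, b, c, hT⟩ := t.exists_triangle (dCone d) (-1) 0 (by lia)
  have hU : U.IsLE (-1) := ⟨hU⟩
  have hV : V.IsGE 0 := ⟨hV⟩
  have hV' : V.IsLE 0 := by
    refine t.isLE₂ _ (rot_of_distTriang _ hT) 0 hP.isLE ?_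
    have := t.isLE_shift U (-1) 1 (-2)
    exact t.isLE_of_le (U⟦(1 : ℤ)⟧) (-2) 0
  obtain ⟨N, ⟨e⟩⟩ := exists_iso_singleFunctor_obj_of_isGE_of_isLE V 0
  refine ⟨N, b ≫ e.hom, ⟨fun M f ↦ ?_, U, a, _, hU, distTriang_of_iso₃ hT e⟩, ⟨?_⟩⟩
  · obtain ⟨k, rfl⟩ := distTriang_desc₃ hT f (t.zero (a ≫ f) (-1) 0)
    obtain ⟨g, hg⟩ := (singleFunctor (ModuleCat.{u} A) 0).map_surjective (e.inv ≫ k)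
    exact ⟨g, by rw [hg, Category.assoc, e.hom_inv_id_assoc]⟩
  -- The fibre U lies in D^{≤-1}, so its cohomology in degrees 0 and 1 vanishes and b is an
  -- isomorphism on H^0.
  · have h₁ : Mono ((homologyFunctor (ModuleCat.{u} A) 0).map b) :=
      (HomologySequence.mono_homologyMap_mor₂_iff _ hT 0).2
        ((isZero_of_isLE U (-1) 0 (by lia)).eq_of_src _ _)
    have h₂ : Epi ((homologyFunctor (ModuleCat.{u} A) 0).map b) :=
      (HomologySequence.epi_homologyMap_mor₂_iff _ hT 0 1).2
        ((isZero_of_isLE U (-1) 1 (by lia)).eq_of_tgt _ _)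
    have : IsIso ((homologyFunctor (ModuleCat.{u} A) 0).map b) := isIso_of_mono_of_epi _
    have e₁ := asIso ((homologyFunctor (ModuleCat.{u} A) 0).map b)
    exact ((homologyFunctorFactors (ModuleCat.{u} A) 0).app (cone d)).symm ≪≫
      e₁ ≪≫
      (homologyFunctor (ModuleCat.{u} A) 0).mapIso e ≪≫
      (singleFunctorCompHomologyFunctorIso (ModuleCat.{u} A) 0).app N

/-- The stalk embedding, localization and shift all preserve direct sums, so compactness of P
applies. -/
lemma classX_sigma (hc : HasFiniteSupports.{u} P) {J : Type u} (M : J → ModuleCat.{u} A)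
    (hM : ∀ j, classX P (M j)) : classX P (∐ M) := by
  have h₁ := Cofan.isColimitMapCoconeEquiv _ M _
    (isColimitOfPreserves (HomologicalComplex.single (ModuleCat.{u} A) (ComplexShape.up ℤ) 0)
      (coproductIsCoproduct M))
  have h₂ := isColimitQCofan h₁
  have h₃ := Cofan.isColimitMapCoconeEquiv _ _ _
    (isColimitOfPreserves (shiftFunctor (DerivedCategory (ModuleCat.{u} A)) (1 : ℤ)) h₂)
  intro f
  exact hc.eq_zero h₃ f fun j ↦ hM j _

namespace IsTwoTerm

variable (hP : IsTwoTerm P)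

include hP

/-- The obstruction lies in Hom(P, K[2]) for the kernel K, which is zero for a two-term P. -/
lemma classX_of_epi {M N : ModuleCat.{u} A} (f : M ⟶ N) [Epi f] (hM : classX P M) :
    classX P N := by
  obtain ⟨_, _, _, hT⟩ := exists_distTriang_of_epi f
  exact homVanishes₃ hT (classX_iff.1 hM)
    (hP.homVanishes_singleFunctor _ 2 (by lia) (by lia))

lemma classY_of_mono {M N : ModuleCat.{u} A} (f : M ⟶ N) [Mono f] (hN : classY P N) :
    classY P M := by
  obtain ⟨_, hT⟩ := exists_distTriang_of_mono f
  exact classY_iff.2 (homVanishes₁ hT (classY_iff.1 hN)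
    (hP.homVanishes_singleFunctor _ (-1) (by lia) (by lia)))

/-- P is an extension of N by an object of D^{≤-1}, and neither receives maps from P after a
positive shift; for N this is membership in 𝒳 in degree 1. -/
lemma homLE_self {N : ModuleCat.{u} A}
    {p : P ⟶ (singleFunctor (ModuleCat.{u} A) 0).obj N} (hp : IsTopModule P p)
    (hN : classX P N) : homLE P 0 P := by
  obtain ⟨U, a, c, hU, hT⟩ := hp.exists_fiber
  intro i hi
  refine homVanishes₂ hT (hP.homVanishes_of_isLE hU i (by lia)) ?_
  by_cases h : i = 1
  · subst h
    exact hN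
  · exact hP.homVanishes_singleFunctor N i (by lia) (by lia)

/-- The torsion part X is the trace of N in M. A morphism from P to M/X lifts to M because Hom(P,
X[1]) = 0; the lift factors through N, so it lands in the trace and dies in the quotient. -/
lemma exists_torsion_sequence (hc : HasFiniteSupports.{u} P) {N : ModuleCat.{u} A}
    {p : P ⟶ (singleFunctor (ModuleCat.{u} A) 0).obj N} (hp : IsTopModule P p) (hN : classX P N) (M : ModuleCat.{u} A) :
    ∃ (X Y : ModuleCat.{u} A) (f : X ⟶ M) (g : M ⟶ Y)
      (δ : (singleFunctor (ModuleCat.{u} A) 0).obj Y ⟶ ((singleFunctor (ModuleCat.{u} A) 0).obj X)⟦(1 : ℤ)⟧), classX P X ∧ classY P Y ∧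
      Triangle.mk ((singleFunctor (ModuleCat.{u} A) 0).map f) ((singleFunctor (ModuleCat.{u} A) 0).map g) δ ∈
        distTriang (DerivedCategory (ModuleCat.{u} A)) := by
  let φ : ∐ (fun _ : (N ⟶ M) ↦ N) ⟶ M := Sigma.desc fun f ↦ f
  have hX : classX P (image φ) := hP.classX_of_epi (factorThruImage φ) (classX_sigma hc _ fun _ ↦ hN)
  obtain ⟨δ, hT⟩ := exists_distTriang_of_mono (image.ι φ)
  refine ⟨_, _, _, _, δ, hX, fun f ↦ ?_, hT⟩
  obtain ⟨k, rfl⟩ := distTriang_lift₂ hT f (hX _)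
  obtain ⟨g, rfl⟩ := hp.exists_fac _ k
  have hg : g = Sigma.ι (fun _ : (N ⟶ M) ↦ N) g ≫ factorThruImage φ ≫ image.ι φ := by
    rw [image.fac, Sigma.ι_desc]
  rw [Category.assoc, ← Functor.map_comp, hg, Category.assoc, Category.assoc, cokernel.condition]
  simp

variable (hXY : ∀ M : ModuleCat.{u} A, classX P M → classY P M → IsZero M)

include hXY

lemma classX_hom_classY {M N : ModuleCat.{u} A} (hM : classX P M) (hN : classY P N)
    (f : M ⟶ N) : f = 0 := by
  have h := hXY (image f) (hP.classX_of_epi (factorThruImage f) hM)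
    (hP.classY_of_mono (image.ι f) hN)
  rw [← image.fac f, h.eq_of_tgt (factorThruImage f) 0, zero_comp]

lemma isLE_of_homLE_neg_one {X : DerivedCategory (ModuleCat.{u} A)} (hX : homLE P (-1) X) :
    X.IsLE (-1) := by
  have : IsLE (X⟦(-1 : ℤ)⟧) 0 := hP.isLE_of_homLE hXY fun i hi ↦
    (homVanishes_shift_iff (-1) i (-1 + i) rfl).2 (hX (-1 + i) (by lia))
  exact t.isLE_of_shift X (-1) (-1) 0

/-- U lies in D^{≤-1} and V in D^{≥-1}, so f is determined by a map H^{-1}(U) ⟶ H^{-1}(V). The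
source is in 𝒳 and the target in 𝒴. -/
lemma hom_eq_zero_of_homLE_of_homGE {U V : DerivedCategory (ModuleCat.{u} A)}
    (hU : homLE P (-1) U) (hV : homGE P 0 V) (f : U ⟶ V) : f = 0 := by
  have hU' := hP.isLE_of_homLE_neg_one hXY hU
  have hV' := hP.isGE_of_homGE hXY hV
  obtain ⟨U₃, U₄, hU₃, hU₄, a, b, c, hT⟩ := t.exists_triangle U (-2) (-1) (by lia)
  have hU₃ : U₃.IsLE (-2) := ⟨hU₃⟩
  have hU₄ : U₄.IsGE (-1) := ⟨hU₄⟩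
  have hU₄' : U₄.IsLE (-1) := by
    refine t.isLE₂ _ (rot_of_distTriang _ hT) (-1) hU' ?_
    have := t.isLE_shift U₃ (-2) 1 (-3)
    exact t.isLE_of_le (U₃⟦(1 : ℤ)⟧) (-3) (-1)
  obtain ⟨V₁, V₂, hV₁, hV₂, a', b', c', hT'⟩ := t.exists_triangle V (-1) 0 (by lia)
  have hV₁ : V₁.IsLE (-1) := ⟨hV₁⟩
  have hV₂ : V₂.IsGE 0 := ⟨hV₂⟩
  have hV₁' : V₁.IsGE (-1) := by
    refine t.isGE₂ _ (inv_rot_of_distTriang _ hT') (-1) ?_ hV'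
    have := t.isGE_shift V₂ 0 (-1) 1
    exact t.isGE_of_ge (V₂⟦(-1 : ℤ)⟧) (-1) 1
  obtain ⟨k, rfl⟩ := distTriang_desc₃ hT f (t.zero (a ≫ f) (-2) (-1))
  obtain ⟨l, rfl⟩ := distTriang_lift₁ hT' k (t.zero (k ≫ b') (-1) 0)
  obtain ⟨M, ⟨e⟩⟩ := exists_iso_singleFunctor_shift U₄ (-1) hU₄' hU₄
  obtain ⟨N, ⟨e'⟩⟩ := exists_iso_singleFunctor_shift V₁ (-1) hV₁ hV₁'
  have hM : classX P M := by
    have : HomVanishes P U₄ 0 := homVanishes₃ hT (hU 0 (by lia))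
      (hP.homVanishes_of_isLE hU₃ 1 (by lia))
    exact ((homVanishes_shift_iff (-1) 1 0 (by lia)).2 this).of_iso e
  have hN : classY P N := by
    have : HomVanishes P V₁ (-1) := homVanishes₁ hT' (hV (-1) (by lia))
      (hP.homVanishes_of_isGE hV₂ (-2) (by lia))
    exact classY_iff.2 (((homVanishes_shift_iff (-1) 0 (-1) (by lia)).2 this).of_iso e')
  have hl : l = 0 := by
    apply (shiftFunctor _ (-1 : ℤ)).map_injective
    obtain ⟨g, hg⟩ := (singleFunctor (ModuleCat.{u} A) 0).map_surjective (e.inv ≫ l⟦-1⟧' ≫ e'.hom)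
    rw [hP.classX_hom_classY hXY hM hN g, Functor.map_zero] at hg
    rw [← cancel_epi e.inv, ← cancel_mono e'.hom, Category.assoc, ← hg]
    simp
  rw [hl, zero_comp, comp_zero]

omit hXY in
/-- The truncation triangles of the t-structure attached to `P`. -/
lemma exists_truncation (hc : HasFiniteSupports.{u} P) {N : ModuleCat.{u} A}
    {p : P ⟶ (singleFunctor (ModuleCat.{u} A) 0).obj N} (hp : IsTopModule P p) (hN : classX P N)
    (Z : DerivedCategory (ModuleCat.{u} A)) :
    ∃ (U V : DerivedCategory (ModuleCat.{u} A)) (_ : homLE P (-1) U) (_ : homGE P 0 V)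
      (a : U ⟶ Z) (b : Z ⟶ V) (c : V ⟶ U⟦(1 : ℤ)⟧),
      Triangle.mk a b c ∈ distTriang (DerivedCategory (ModuleCat.{u} A)) := by
  obtain ⟨Z₁, Z₂, hZ₁, hZ₂, a₁, b₁, c₁, hT₁⟩ := t.exists_triangle Z (-1) 0 (by lia)
  have hZ₁ : Z₁.IsLE (-1) := ⟨hZ₁⟩
  have hZ₂ : Z₂.IsGE 0 := ⟨hZ₂⟩
  obtain ⟨Z₃, Z₄, hZ₃, hZ₄, a₂, b₂, c₂, hT₂⟩ := t.exists_triangle Z₁ (-2) (-1) (by lia)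
  have hZ₃ : Z₃.IsLE (-2) := ⟨hZ₃⟩
  have hZ₄ : Z₄.IsGE (-1) := ⟨hZ₄⟩
  have hZ₄' : Z₄.IsLE (-1) := by
    refine t.isLE₂ _ (rot_of_distTriang _ hT₂) (-1) hZ₁ ?_
    have := t.isLE_shift Z₃ (-2) 1 (-3)
    exact t.isLE_of_le (Z₃⟦(1 : ℤ)⟧) (-3) (-1)
  obtain ⟨M, ⟨e⟩⟩ := exists_iso_singleFunctor_shift Z₄ (-1) hZ₄' hZ₄
  obtain ⟨X, Y, f, g, δ, hX, hY, hT₃⟩ := hP.exists_torsion_sequence hc hp hN M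
  let e' : Z₄ ≅ ((singleFunctor (ModuleCat.{u} A) 0).obj M)⟦(1 : ℤ)⟧ :=
    (shiftFunctorCompIsoId _ (-1 : ℤ) 1 (by lia)).symm.app Z₄ ≪≫ (shiftFunctor _ (1 : ℤ)).mapIso e
  -- With M = H^{-1}(Z) and torsion part X, the object U is the fibre of τ^{≤-1} Z ⟶ M[1] ⟶ Y[1]: it
  -- keeps τ^{≤-2} Z and only the torsion part of M.
  obtain ⟨U, x, y, hU, m, m', δ', hm⟩ := exists_fiber_comp (distTriang_of_iso₃ hT₂ e')
    (Triangle.shift_distinguished _ hT₃ 1)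
  obtain ⟨V, z, v, hV⟩ := distinguished_cocone_triangle (x ≫ a₁)
  -- The octahedron on U ⟶ τ^{≤-1} Z ⟶ Z presents V as an extension of τ^{≥0} Z by Y[1].
  let H := Triangulated.someOctahedron rfl hU hT₁ hV
  refine ⟨U, V, fun i hi ↦ ?_, fun i hi ↦ ?_, _, _, _, hV⟩
  · refine (homVanishes_shift_iff 1 (i - 1) i (by lia)).1 (homVanishes₂ hm ?_ ?_)
    · exact (homVanishes_shift_iff 1 (i - 1) i (by lia)).2
        (hP.homVanishes_of_isLE hZ₃ i (by lia))
    · refine (homVanishes_shift_iff 1 (i - 1) i (by lia)).2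
        ((homVanishes_shift_iff 1 i (i + 1) (by lia)).2 ?_)
      by_cases hi' : i = 0
      · subst hi'
        exact hX
      · exact hP.homVanishes_singleFunctor X (i + 1) (by lia) (by lia)
  · refine homVanishes₂ H.mem ?_ (hP.homVanishes_of_isGE hZ₂ i hi)
    refine (homVanishes_shift_iff 1 i (i + 1) (by lia)).2 ?_
    by_cases hi' : i = -1
    · subst hi'
      exact classY_iff.1 hY
    · exact hP.homVanishes_singleFunctor Y (i + 1) (by lia) (by lia)

end IsTwoTerm

end Derived


/-! ### The heart is admissible abelian. -/

section Heart

variable {T : Type w'} [Category.{w} T] [Preadditive T] [HasZeroObject T] [HasShift T ℤ]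
  [∀ n : ℤ, (shiftFunctor T n).Additive] [Pretriangulated T] {P : T}

/-- The subcategories `homLE P n` and `homGE P n` form a t-structure. -/
structure InducesTStructure (P : T) : Prop where
  hom_eq_zero : ∀ ⦃U V : T⦄, homLE P (-1) U → homGE P 0 V → ∀ f : U ⟶ V, f = 0
  exists_truncation : ∀ Z : T, ∃ (U V : T) (_ : homLE P (-1) U) (_ : homGE P 0 V)
    (a : U ⟶ Z) (b : Z ⟶ V) (c : V ⟶ U⟦(1 : ℤ)⟧), Triangle.mk a b c ∈ distTriang T

omit [HasZeroObject T] [∀ n : ℤ, (shiftFunctor T n).Additive] [Pretriangulated T] in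
lemma homHeart_iff {X : T} : homHeart P X ↔ ∀ i : ℤ, i ≠ 0 → HomVanishes P X i :=
  ⟨fun h i hi ↦ (lt_or_gt_of_ne hi).elim (h.2 i) (h.1 i),
    fun h ↦ ⟨fun i hi ↦ h i (by lia), fun i hi ↦ h i (by lia)⟩⟩

omit [HasZeroObject T] [∀ n : ℤ, (shiftFunctor T n).Additive] [Pretriangulated T] in
lemma homHeart_of_iso {X Y : T} (e : X ≅ Y) (hX : homHeart P X) : homHeart P Y :=
  homHeart_iff.2 fun i hi ↦ (homHeart_iff.1 hX i hi).of_iso e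

lemma homHeart_isClosedUnderFiniteProducts : (homHeart P).IsClosedUnderFiniteProducts where
  isClosedUnderLimitsOfShape J _ := ⟨by
    rintro X ⟨p⟩
    refine homHeart_iff.2 fun i hi f ↦ ?_
    refine (isLimitOfPreserves (shiftFunctor T i) p.isLimit).hom_ext fun j ↦ ?_
    rw [zero_comp]
    exact homHeart_iff.1 (p.prop_diag_obj j) i hi _⟩

namespace InducesTStructure

variable (hP : InducesTStructure P)

include hP

lemma hom_shift_eq_zero {X Y : T} (hX : homHeart P X) (hY : homHeart P Y) (n : ℤ) (hn : n < 0)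
    (f : X ⟶ Y⟦n⟧) : f = 0 := by
  have hX' : homLE P (-1) (X⟦-n⟧) := fun i hi ↦
    (homVanishes_shift_iff (-n) i (-n + i) rfl).2 (hX.1 _ (by lia))
  apply (shiftFunctor T (-n)).map_injective
  rw [Functor.map_zero, ← cancel_mono ((shiftFunctorCompIsoId T n (-n) (by lia)).hom.app Y),
    zero_comp]
  exact hP.hom_eq_zero hX' hY.2 _

lemma isAdmissibleAbelian_homHeart : IsAdmissibleAbelian (homHeart P) where
  finite_sums := homHeart_isClosedUnderFiniteProducts
  hom_eq_zero _ _ hX hY n hn f := hP.hom_shift_eq_zero hX hY n hn f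
  admissible := by
    ext X₁ X₂ f₁
    simp only [MorphismProperty.top_apply, iff_true]
    intro X₃ f₂ f₃ hT
    obtain ⟨U, V, hU, hV, a, b, c, hT'⟩ := hP.exists_truncation X₃
    -- The cone is seen by P only in degrees -1 and 0, so its truncation pieces are N[1] and Q with
    -- N = U[-1] and Q = V in the heart.
    have hX₃ (i : ℤ) (h₀ : i ≠ 0) (h₁ : i ≠ -1) : HomVanishes P X₃ i :=
      homVanishes₃ hT (homHeart_iff.1 X₂.property i h₀)
        (homHeart_iff.1 X₁.property (i + 1) (by lia))
    have hU' : homHeart P (U⟦(-1 : ℤ)⟧) := homHeart_iff.2 fun i hi ↦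
      (homVanishes_shift_iff (-1) i (-1 + i) rfl).2 (by
        by_cases h : 0 < i
        · exact hU _ (by lia)
        · exact homVanishes₁ hT' (hX₃ (-1 + i) (by lia) (by lia)) (hV (-1 + i - 1) (by lia)))
    have hV' : homHeart P V := homHeart_iff.2 fun i hi ↦ by
      by_cases h : i < 0
      · exact hV i h
      · exact homVanishes₃ hT' (hX₃ i (by lia) (by lia)) (hU (i + 1) (by lia))
    let e : U⟦(-1 : ℤ)⟧⟦(1 : ℤ)⟧ ≅ U := (shiftFunctorCompIsoId T (-1 : ℤ) 1 (by lia)).app U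
    refine ⟨⟨_, hU'⟩, ⟨_, hV'⟩, e.hom ≫ a, b, c ≫ e.inv⟦1⟧', ?_⟩
    refine isomorphic_distinguished _ hT' _ ?_
    refine Triangle.isoMk _ _ e (Iso.refl _) (Iso.refl _) (Category.comp_id _)
      ((Category.comp_id b).trans (Category.id_comp b).symm) ?_
    change (c ≫ e.inv⟦1⟧') ≫ e.hom⟦1⟧' = 𝟙 V ≫ c
    rw [Category.assoc, ← Functor.map_comp, e.inv_hom_id, CategoryTheory.Functor.map_id, Category.comp_id,
      Category.id_comp]

omit hP in
lemma hom_shift_eq_zero_ι (hP : InducesTStructure P) ⦃X Y : (homHeart P).FullSubcategory⦄ ⦃n : ℤ⦄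
    (f : (homHeart P).ι.obj X ⟶ ((homHeart P).ι.obj Y)⟦n⟧) (hn : n < 0) : f = 0 :=
  hP.hom_shift_eq_zero X.property Y.property n hn f

/-- The heart of the t-structure attached to `P` is an abelian category. -/
noncomputable abbrev abelianHomHeart [IsTriangulated T] : Abelian (homHeart P).FullSubcategory :=
  have : (homHeart P).IsClosedUnderFiniteProducts := homHeart_isClosedUnderFiniteProducts
  Triangulated.AbelianSubcategory.abelian (homHeart P).ι hP.hom_shift_eq_zero_ι
    hP.isAdmissibleAbelian_homHeart.admissible

lemma abelianHomHeart_toPreadditive [IsTriangulated T] :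
    hP.abelianHomHeart.toPreadditive =
      (inferInstance : Preadditive (homHeart P).FullSubcategory) := rfl

/-- Vanishing of negative Homs makes f a kernel of g and g a cokernel of f. -/
lemma shortExact_of_distTriang [IsTriangulated T] {X Y Z : (homHeart P).FullSubcategory}
    (f : X ⟶ Y) (g : Y ⟶ Z) {h : Z.obj ⟶ X.obj⟦(1 : ℤ)⟧}
    (hT : Triangle.mk f.hom g.hom h ∈ distTriang T) (w : f ≫ g = 0) :
    (ShortComplex.mk f g w).ShortExact := by
  have : (homHeart P).IsClosedUnderFiniteProducts := homHeart_isClosedUnderFiniteProducts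
  have hk := Triangulated.AbelianSubcategory.isLimitKernelForkOfDistTriang hP.hom_shift_eq_zero_ι f g h hT
  have hc := Triangulated.AbelianSubcategory.isColimitCokernelCoforkOfDistTriang hP.hom_shift_eq_zero_ι f g h hT
  let ab := hP.abelianHomHeart
  have : (ShortComplex.mk f g w).HasHomology :=
    @CategoryWithHomology.hasHomology _ _ _ (@categoryWithHomology_of_abelian _ _ ab) _
  exact { exact := ShortComplex.exact_of_f_is_kernel _ hk
          mono_f := mono_of_isLimit_fork hk
          epi_g := epi_of_isColimit_cofork hc }

end InducesTStructure

end Heart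

/-! ### The torsion theory in the heart. -/

section Derived

open DerivedCategory DerivedCategory.TStructure

variable {A : Type u} [Ring A] [HasDerivedCategory.{w} (ModuleCat.{u} A)]
  {P : DerivedCategory (ModuleCat.{u} A)}

lemma derivedYShift.isLE {X : DerivedCategory (ModuleCat.{u} A)} (hX : derivedYShift P X) :
    X.IsLE (-1) := by
  obtain ⟨M, _, ⟨e⟩⟩ := hX
  have : IsLE ((singleFunctor (ModuleCat.{u} A) 0 ⋙ shiftFunctor _ (1 : ℤ)).obj M) (-1) :=
    t.isLE_shift ((singleFunctor (ModuleCat.{u} A) 0).obj M) 0 1 (-1)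
  exact t.isLE_of_iso e (-1)

lemma derivedX.isGE {X : DerivedCategory (ModuleCat.{u} A)} (hX : derivedX P X) :
    X.IsGE 0 := by
  obtain ⟨M, _, ⟨e⟩⟩ := hX
  exact t.isGE_of_iso e 0

lemma derivedYShift.of_iso {X Y : DerivedCategory (ModuleCat.{u} A)} (e : X ≅ Y)
    (hX : derivedYShift P X) : derivedYShift P Y := by
  obtain ⟨M, hM, ⟨e'⟩⟩ := hX
  exact ⟨M, hM, ⟨e' ≪≫ e⟩⟩

lemma derivedX.of_iso {X Y : DerivedCategory (ModuleCat.{u} A)} (e : X ≅ Y)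
    (hX : derivedX P X) : derivedX P Y := by
  obtain ⟨M, hM, ⟨e'⟩⟩ := hX
  exact ⟨M, hM, ⟨e' ≪≫ e⟩⟩

lemma derivedYShift_of_isZero {X : DerivedCategory (ModuleCat.{u} A)} (hX : IsZero X) :
    derivedYShift P X := by
  have h₀ := Functor.map_isZero (singleFunctor (ModuleCat.{u} A) 0)
    (isZero_zero (ModuleCat.{u} A))
  exact ⟨_, classY_iff.2 (homVanishes_of_isZero h₀ 0),
    ⟨(Functor.map_isZero (shiftFunctor _ (1 : ℤ)) h₀).iso hX⟩⟩

lemma derivedX_of_isZero {X : DerivedCategory (ModuleCat.{u} A)} (hX : IsZero X) :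
    derivedX P X := by
  have h₀ := Functor.map_isZero (singleFunctor (ModuleCat.{u} A) 0)
    (isZero_zero (ModuleCat.{u} A))
  exact ⟨_, homVanishes_of_isZero h₀ 1, ⟨h₀.iso hX⟩⟩

namespace IsTwoTerm

variable (hP : IsTwoTerm P)

include hP

lemma derivedYShift_le : derivedYShift P ≤ homHeart P := by
  rintro X ⟨M, hM, ⟨e⟩⟩
  refine homHeart_of_iso e (homHeart_iff.2 fun i hi ↦
    (homVanishes_shift_iff 1 i (i + 1) (by lia)).2 ?_)
  by_cases h : i = -1
  · subst h
    exact classY_iff.1 hM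
  · exact hP.homVanishes_singleFunctor M (i + 1) (by lia) (by lia)

lemma derivedX_le : derivedX P ≤ homHeart P := by
  rintro X ⟨M, hM, ⟨e⟩⟩
  refine homHeart_of_iso e (homHeart_iff.2 fun i hi ↦ ?_)
  by_cases h : i = 1
  · subst h
    exact hM
  · exact hP.homVanishes_singleFunctor M i hi h

variable (hXY : ∀ M : ModuleCat.{u} A, classX P M → classY P M → IsZero M)

include hXY

/-- A heart object has standard cohomology only in degrees -1 and 0; the long exact sequence of
Hom(P, -) puts H^{-1} in 𝒴 and H^0 in 𝒳. -/
lemma exists_distTriang_of_homHeart {M : DerivedCategory (ModuleCat.{u} A)} (hM : homHeart P M) :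
    ∃ (M₁ M₂ : DerivedCategory (ModuleCat.{u} A)) (a : M₁ ⟶ M) (b : M ⟶ M₂)
      (c : M₂ ⟶ M₁⟦(1 : ℤ)⟧), derivedYShift P M₁ ∧ derivedX P M₂ ∧
      Triangle.mk a b c ∈ distTriang (DerivedCategory (ModuleCat.{u} A)) := by
  obtain ⟨M₁, M₂, h₁, h₂, a, b, c, hT⟩ := t.exists_triangle M (-1) 0 (by lia)
  have h₁ : M₁.IsLE (-1) := ⟨h₁⟩
  have h₂ : M₂.IsGE 0 := ⟨h₂⟩
  have h₁' : M₁.IsGE (-1) := by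
    refine t.isGE₂ _ (inv_rot_of_distTriang _ hT) (-1) ?_ (hP.isGE_of_homGE hXY hM.2)
    have := t.isGE_shift M₂ 0 (-1) 1
    exact t.isGE_of_ge (M₂⟦(-1 : ℤ)⟧) (-1) 1
  have h₂' : M₂.IsLE 0 := by
    refine t.isLE₂ _ (rot_of_distTriang _ hT) 0 (hP.isLE_of_homLE hXY hM.1) ?_
    have := t.isLE_shift M₁ (-1) 1 (-2)
    exact t.isLE_of_le (M₁⟦(1 : ℤ)⟧) (-2) 0
  refine ⟨M₁, M₂, a, b, c, ?_, ?_, hT⟩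
  · obtain ⟨Y, ⟨e⟩⟩ := exists_iso_singleFunctor_shift M₁ (-1) h₁ h₁'
    refine ⟨Y, ?_, ⟨(shiftFunctor _ (1 : ℤ)).mapIso e.symm ≪≫
      (shiftFunctorCompIsoId _ (-1 : ℤ) 1 (by lia)).app M₁⟩⟩
    have : HomVanishes P M₁ (-1) := homVanishes₁ hT (hM.2 (-1) (by lia))
      (hP.homVanishes_of_isGE h₂ (-2) (by lia))
    exact classY_iff.2 (((homVanishes_shift_iff (-1) 0 (-1) (by lia)).2 this).of_iso e)
  · obtain ⟨X, ⟨e⟩⟩ := exists_iso_singleFunctor_obj_of_isGE_of_isLE M₂ 0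
    refine ⟨X, ?_, ⟨e.symm⟩⟩
    have : HomVanishes P M₂ 1 := homVanishes₃ hT (hM.1 1 (by lia))
      (hP.homVanishes_of_isLE h₁ 2 (by lia))
    exact this.of_iso e

lemma isTorsionTheory (hP' : InducesTStructure P) :
    IsTorsionTheory ((derivedYShift P).inverseImage (homHeart P).ι)
      ((derivedX P).inverseImage (homHeart P).ι) where
  inter M := by
    constructor
    · rintro ⟨h₁, h₂⟩
      have := derivedYShift.isLE h₁
      have := derivedX.isGE h₂
      rw [IsZero.iff_id_eq_zero]
      exact (homHeart P).ι.map_injective (t.zero _ (-1) 0)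
    · intro h
      have : IsZero M.obj := Functor.map_isZero (homHeart P).ι h
      exact ⟨derivedYShift_of_isZero this, derivedX_of_isZero this⟩
  of_epi := by
    intro M N f _ hM
    have hM' : M.obj.IsLE (-1) := derivedYShift.isLE hM
    obtain ⟨N₁, N₂, a, b, c, h₁, h₂, hT⟩ := hP.exists_distTriang_of_homHeart hXY N.property
    have h₁' := derivedYShift.isLE h₁
    have h₂' := derivedX.isGE h₂
    let N₂' : (homHeart P).FullSubcategory := ⟨N₂, hP.derivedX_le _ h₂⟩
    let q : N ⟶ N₂' := ObjectProperty.homMk b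
    -- The composite M ⟶ N ⟶ N₂ goes from D^{≤-1} to D^{≥0}, so it vanishes, and f is epi. Then the
    -- identity of N₂ factors through N₁[1] in D^{≤-2}, forcing N₂ = 0.
    have hq : q = 0 := by
      rw [← cancel_epi f, comp_zero]
      exact (homHeart P).ι.map_injective (t.zero (f.hom ≫ b) (-1) 0)
    have hb : b = 0 := (homHeart P).ι.congr_map hq
    obtain ⟨l, hl⟩ := distTriang_desc₁ hT (𝟙 N₂) (by rw [hb, zero_comp])
    have : IsLE (N₁⟦(1 : ℤ)⟧) (-2) := t.isLE_shift N₁ (-1) 1 (-2)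
    rw [t.zero l (-2) 0, comp_zero] at hl
    have : IsIso a := (Triangle.isZero₃_iff_isIso₁ _ hT).1 ((IsZero.iff_id_eq_zero N₂).2 hl)
    exact derivedYShift.of_iso (asIso a) h₁
  of_mono := by
    intro M N f _ hN
    have hN' : N.obj.IsGE 0 := derivedX.isGE hN
    obtain ⟨M₁, M₂, a, b, c, h₁, h₂, hT⟩ := hP.exists_distTriang_of_homHeart hXY M.property
    have h₁' := derivedYShift.isLE h₁
    have h₂' := derivedX.isGE h₂
    let M₁' : (homHeart P).FullSubcategory := ⟨M₁, hP.derivedYShift_le _ h₁⟩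
    let q : M₁' ⟶ M := ObjectProperty.homMk a
    have hq : q = 0 := by
      rw [← cancel_mono f, zero_comp]
      exact (homHeart P).ι.map_injective (t.zero (a ≫ f.hom) (-1) 0)
    have ha : a = 0 := (homHeart P).ι.congr_map hq
    obtain ⟨l, hl⟩ := distTriang_lift₃ hT (𝟙 (M₁⟦(1 : ℤ)⟧)) (by
      rw [ha, Functor.map_zero, comp_zero])
    have : IsLE (M₁⟦(1 : ℤ)⟧) (-2) := t.isLE_shift M₁ (-1) 1 (-2)
    rw [t.zero l (-2) 0, zero_comp] at hl
    have hM₁ : IsZero M₁ := (Functor.map_isZero (shiftFunctor _ (-1 : ℤ))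
      ((IsZero.iff_id_eq_zero _).2 hl)).of_iso
        ((shiftFunctorCompIsoId _ (1 : ℤ) (-1) (by lia)).symm.app M₁)
    have : IsIso b := (Triangle.isZero₁_iff_isIso₂ _ hT).1 hM₁
    exact derivedX.of_iso (asIso b).symm h₂
  exists_shortExact M := by
    obtain ⟨M₁, M₂, a, b, c, h₁, h₂, hT⟩ := hP.exists_distTriang_of_homHeart hXY M.property
    exact ⟨⟨M₁, hP.derivedYShift_le _ h₁⟩, ⟨M₂, hP.derivedX_le _ h₂⟩, ObjectProperty.homMk a,
      ObjectProperty.homMk b, (homHeart P).ι.map_injective (distTriang_comp₁₂ hT),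
      hP'.shortExact_of_distTriang _ _ hT _, h₁, h₂⟩

end IsTwoTerm

end Derived


/-! ### Hom(P, -) of a direct sum of copies of P is a free module. -/

section Linear

variable {C : Type w'} [Category.{w} C] [Preadditive C] {P : C}

/-- Postcomposition with a morphism, as a linear map over the opposite endomorphism ring. -/
def postcomp (P : C) {X Y : C} (f : X ⟶ Y) : (P ⟶ X) →ₗ[(End P)ᵐᵒᵖ] (P ⟶ Y) where
  toFun x := x ≫ f
  map_add' _ _ := Preadditive.add_comp _ _ _ _ _ _
  map_smul' _ _ := Category.assoc _ _ _

@[simp]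
lemma postcomp_apply {X Y : C} (f : X ⟶ Y) (x : P ⟶ X) : postcomp P f x = x ≫ f := rfl

lemma comp_eq_smul {X : C} (a : P ⟶ P) (x : P ⟶ X) :
    a ≫ x = (MulOpposite.op a : (End P)ᵐᵒᵖ) • x := rfl

variable {J : Type u} {c : Cofan (fun _ : J ↦ P)} (hc : IsColimit c)
  (hP : HasFiniteSupports.{u} P) {M : Type*} [AddCommGroup M] [Module (End P)ᵐᵒᵖ M]

include hc hP in
lemma linearMap_ext_of_cofan {φ ψ : (P ⟶ c.pt) →ₗ[(End P)ᵐᵒᵖ] M}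
    (h : ∀ j, φ (c.inj j) = ψ (c.inj j)) : φ = ψ := by
  ext x
  obtain ⟨F, hF⟩ := hP J _ c hc x
  rw [← hF, cofanIdem, Preadditive.comp_sum, map_sum, map_sum]
  refine Finset.sum_congr rfl fun j _ ↦ ?_
  rw [← Category.assoc, comp_eq_smul, map_smul, map_smul, h]

include hc hP in
-- The injections form a basis of Hom(P, c.pt): finite supports let the values m be extended by the
-- coordinates `x ≫ cofanProj hc j`.
lemma exists_linearMap_of_cofan (m : J → M) :
    ∃ φ : (P ⟶ c.pt) →ₗ[(End P)ᵐᵒᵖ] M, ∀ j, φ (c.inj j) = m j := by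
  have fin (x : P ⟶ c.pt) :
      (Function.support fun j ↦ (MulOpposite.op (x ≫ cofanProj hc j) : (End P)ᵐᵒᵖ) • m j).Finite := by
    obtain ⟨F, hF⟩ := hP J _ c hc x
    refine F.finite_toSet.subset fun j hj ↦ ?_
    by_contra h
    refine hj ?_
    simp only [comp_cofanProj_of_notMem hc hF h]
    exact zero_smul _ _
  refine ⟨{ toFun := fun x ↦ ∑ᶠ j, (MulOpposite.op (x ≫ cofanProj hc j) : (End P)ᵐᵒᵖ) • m j
            map_add' := fun x y ↦ ?_
            map_smul' := fun r x ↦ ?_ }, fun j ↦ ?_⟩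
  · rw [← finsum_add_distrib (fin x) (fin y)]
    refine finsum_congr fun j ↦ ?_
    rw [Preadditive.add_comp, ← add_smul]
    rfl
  · rw [RingHom.id_apply, smul_finsum' r (fin x)]
    refine finsum_congr fun j ↦ ?_
    rw [smul_smul]
    congr 1
    exact congrArg MulOpposite.op (Category.assoc _ _ _)
  · change ∑ᶠ i, (MulOpposite.op (c.inj j ≫ cofanProj hc i) : (End P)ᵐᵒᵖ) • m i = m j
    rw [finsum_eq_single _ j]
    · rw [inj_cofanProj_self]
      exact one_smul _ _
    · intro i hi
      rw [inj_cofanProj_of_ne hc hi.symm]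
      exact zero_smul _ _

end Linear

/-! ### P as a projective generator relative to the heart. -/

section Equivalence

variable {T : Type w'} [Category.{w} T] {P : T}

/-- Every small family of morphisms from `P` to `X` is obtained from a morphism
from a direct sum of copies of `P`. -/
lemma exists_cofan_desc [HasCoproducts.{u} T] {X : T} (S : Set (P ⟶ X)) [Small.{u} S] :
    ∃ (J : Type u) (c : Cofan (fun _ : J ↦ P)) (_ : Nonempty (IsColimit c)) (e : c.pt ⟶ X),
      (∀ j, c.inj j ≫ e ∈ S) ∧ ∀ x ∈ S, ∃ j, c.inj j ≫ e = x := by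
  let J := Shrink.{u} S
  let c : Cofan (fun _ : J ↦ P) := Cofan.mk _ (Sigma.ι _)
  have hc : IsColimit c := coproductIsCoproduct _
  let e : c.pt ⟶ X := Cofan.IsColimit.desc hc fun j ↦ ((equivShrink S).symm j : P ⟶ X)
  have he (j : J) : c.inj j ≫ e = ((equivShrink S).symm j : P ⟶ X) :=
    Cofan.IsColimit.fac hc _ j
  refine ⟨J, c, ⟨hc⟩, e, fun j ↦ ?_, fun x hx ↦ ⟨equivShrink S ⟨x, hx⟩, ?_⟩⟩
  · rw [he]
    exact Subtype.property _
  · rw [he, Equiv.symm_apply_apply]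

variable [Preadditive T] [HasShift T ℤ]

lemma homVanishes_cofan (hfin : HasFiniteSupports.{u} P) {J : Type u}
    {c : Cofan (fun _ : J ↦ P)} (hc : IsColimit c) {i : ℤ} (h : HomVanishes P P i) :
    HomVanishes P c.pt i := by
  intro f
  have hc' := Cofan.isColimitMapCoconeEquiv _ _ _ (isColimitOfPreserves (shiftFunctor T i) hc)
  exact hfin.eq_zero hc' f fun j ↦ h _

namespace InducesTStructure

variable [HasZeroObject T] [∀ n : ℤ, (shiftFunctor T n).Additive] [Pretriangulated T]
  [HasCoproducts.{u} T] (hP : InducesTStructure P) (hfin : HasFiniteSupports.{u} P)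
  (hP₀ : homLE P 0 P) [∀ X : T, Small.{u} (P ⟶ X)]

include hP hfin hP₀

/-- Cover W by copies of P: f vanishes on the cover, so it factors through the cone, which lies in
`homLE P (-1)`. One-sided bounds on W and Y are needed because fullness applies this to a fibre W
that may leave the heart. -/
lemma eq_zero_of_homLE_of_homGE {W Y : T} (hW : homLE P 0 W) (hY : homGE P 0 Y) (f : W ⟶ Y)
    (hf : ∀ x : P ⟶ W, x ≫ f = 0) : f = 0 := by
  obtain ⟨J, c, ⟨hc⟩, e, -, he⟩ := exists_cofan_desc.{u} (Set.univ : Set (P ⟶ W))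
  obtain ⟨Z, g, δ, hT⟩ := distinguished_cocone_triangle e
  have hS {i : ℤ} (hi : 0 < i) : HomVanishes P c.pt i :=
    homVanishes_cofan hfin hc (hP₀ i hi)
  have hZ : homLE P (-1) Z := by
    intro i hi
    by_cases h : i = 0
    · subst h
      refine homVanishes_zero_iff.2 fun x ↦ ?_
      obtain ⟨y, rfl⟩ := distTriang_lift₂ hT x (hS (by lia) _)
      obtain ⟨j, rfl⟩ := he y trivial
      rw [Category.assoc, distTriang_comp₁₂ hT, comp_zero]
    · exact homVanishes₃ hT (hW i (by lia)) (hS (i := i + 1) (by lia))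
  obtain ⟨l, rfl⟩ := distTriang_desc₃ hT f (by
    refine Cofan.IsColimit.hom_ext hc _ _ fun j ↦ ?_
    rw [← Category.assoc, hf, comp_zero])
  rw [hP.hom_eq_zero hZ hY l, comp_zero]

/-- Realize φ on a cover of X by copies of P. The realization h kills the fibre W of the cover,
since it does so after applying Hom(P, -), and therefore descends to X. -/
lemma exists_eq_postcomp {X Y : T} (hX : homHeart P X) (hY : homHeart P Y)
    (φ : (P ⟶ X) →ₗ[(End P)ᵐᵒᵖ] (P ⟶ Y)) : ∃ f : X ⟶ Y, ∀ x : P ⟶ X, x ≫ f = φ x := by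
  obtain ⟨J, c, ⟨hc⟩, e, -, he⟩ := exists_cofan_desc.{u} (Set.univ : Set (P ⟶ X))
  obtain ⟨W, k, δ, hT⟩ := distinguished_cocone_triangle₁ e
  have hS {i : ℤ} (hi : 0 < i) : HomVanishes P c.pt i :=
    homVanishes_cofan hfin hc (hP₀ i hi)
  let h : c.pt ⟶ Y := Cofan.IsColimit.desc hc fun j ↦ φ (c.inj j ≫ e)
  have hh : postcomp P h = φ ∘ₗ postcomp P e :=
    linearMap_ext_of_cofan hc hfin fun j ↦ Cofan.IsColimit.fac hc _ j
  replace hh (x : P ⟶ c.pt) : x ≫ h = φ (x ≫ e) := LinearMap.congr_fun hh x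
  have hW : homLE P 0 W := by
    intro i hi
    by_cases h : i = 1
    · subst h
      intro x
      obtain ⟨y, rfl⟩ := distTriang_lift₃ hT x (hS (by lia) _)
      obtain ⟨j, rfl⟩ := he y trivial
      rw [Category.assoc, distTriang_comp₂₃ hT, comp_zero]
    · exact homVanishes₁ hT (hS hi) (hX.1 (i - 1) (by lia))
  have hk : k ≫ h = 0 := by
    refine hP.eq_zero_of_homLE_of_homGE hfin hP₀ hW hY.2 _ fun x ↦ ?_
    rw [← Category.assoc, hh, Category.assoc, distTriang_comp₁₂ hT, comp_zero, map_zero]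
  obtain ⟨f, hf⟩ := distTriang_desc₃ hT h hk
  refine ⟨f, fun x ↦ ?_⟩
  obtain ⟨j, rfl⟩ := he x trivial
  rw [Category.assoc, ← hf, hh]

/-- Lift a free presentation of M to a morphism e between sums of copies of P, and let X be the
truncation of its cone to `homGE P 0`. Since U and the positive shifts of the sums are invisible to
P, Hom(P, X) is the cokernel of the presentation. -/
lemma exists_linearEquiv (M : Type w) [AddCommGroup M] [Module (End P)ᵐᵒᵖ M] [Small.{u} M] :
    ∃ X : T, homHeart P X ∧ Nonempty ((P ⟶ X) ≃ₗ[(End P)ᵐᵒᵖ] M) := by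
  let c : Cofan (fun _ : Shrink.{u} M ↦ P) := Cofan.mk _ (Sigma.ι _)
  have hc : IsColimit c := coproductIsCoproduct _
  obtain ⟨ψ, hψ⟩ := exists_linearMap_of_cofan hc hfin fun j ↦ (equivShrink M).symm j
  have hψ' : Function.Surjective ψ := fun m ↦
    ⟨c.inj (equivShrink M m), by rw [hψ, Equiv.symm_apply_apply]⟩
  obtain ⟨J', c', ⟨hc'⟩, e, he, he'⟩ := exists_cofan_desc.{u} {x : P ⟶ c.pt | ψ x = 0}
  obtain ⟨Z, g, δ, hT⟩ := distinguished_cocone_triangle e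
  obtain ⟨U, X, hU, hX, a, b, d, hT'⟩ := hP.exists_truncation Z
  have hS {i : ℤ} (hi : 0 < i) : HomVanishes P c.pt i :=
    homVanishes_cofan hfin hc (hP₀ i hi)
  have hS' {i : ℤ} (hi : 0 < i) : HomVanishes P c'.pt i :=
    homVanishes_cofan hfin hc' (hP₀ i hi)
  have hX' : homHeart P X := ⟨fun i hi ↦ homVanishes₃ hT'
    (homVanishes₃ hT (hS hi) (hS' (i := i + 1) (by lia))) (hU (i + 1) (by lia)), hX⟩
  have hsurj : Function.Surjective (postcomp P (g ≫ b)) := fun x ↦ by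
    obtain ⟨y, rfl⟩ := distTriang_lift₂ hT' x (hU 1 (by lia) _)
    obtain ⟨z, rfl⟩ := distTriang_lift₂ hT y (hS' (by lia) _)
    exact ⟨z, (Category.assoc _ _ _).symm⟩
  have hψe : ψ ∘ₗ postcomp P e = 0 := linearMap_ext_of_cofan hc' hfin fun j ↦ he j
  have hker : LinearMap.ker (postcomp P (g ≫ b)) = LinearMap.ker ψ := by
    ext x
    rw [LinearMap.mem_ker, LinearMap.mem_ker, postcomp_apply]
    constructor
    · intro hx
      obtain ⟨y, hy⟩ := distTriang_lift₁ hT' (x ≫ g) (by rw [Category.assoc, hx])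
      rw [homVanishes_zero_iff.1 (hU 0 (by lia)) y, zero_comp] at hy
      obtain ⟨z, rfl⟩ := distTriang_lift₁ hT x hy
      exact LinearMap.congr_fun hψe z
    · intro hx
      obtain ⟨j, rfl⟩ := he' x hx
      rw [Category.assoc, ← Category.assoc e, distTriang_comp₁₂ hT, zero_comp, comp_zero]
  exact ⟨X, hX', ⟨((postcomp P (g ≫ b)).quotKerEquivOfSurjective hsurj).symm ≪≫ₗ
    Submodule.quotEquivOfEq _ _ hker ≪≫ₗ ψ.quotKerEquivOfSurjective hψ'⟩⟩

end InducesTStructure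

end Equivalence

/-! ### Smallness of Hom(P, X) and the equivalence. -/

section Derived

open DerivedCategory

variable {A : Type u} [Ring A] [HasDerivedCategory.{w} (ModuleCat.{u} A)]
  {P : DerivedCategory (ModuleCat.{u} A)}

/-- Every such morphism comes from a chain map, and chain maps form a `u`-small set. Smallness is
what permits direct sums indexed by Hom(P, X). -/
lemma small_hom_singleFunctor (M : ModuleCat.{u} A) [Projective M]
    (X : DerivedCategory (ModuleCat.{u} A)) :
    Small.{u} ((singleFunctor (ModuleCat.{u} A) 0).obj M ⟶ X) := by
  let K := (HomologicalComplex.single (ModuleCat.{u} A) (ComplexShape.up ℤ) 0).obj M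
  let e := Q.objObjPreimageIso X
  refine small_of_surjective.{u} (f := fun g : K ⟶ Q.objPreimage X ↦
    ((Q.map g ≫ e.hom : Q.obj K ⟶ X) : (singleFunctor (ModuleCat.{u} A) 0).obj M ⟶ X))
    fun (f : Q.obj K ⟶ X) ↦ ?_
  obtain ⟨g, hg⟩ := exists_Q_map_eq (f ≫ e.inv)
  refine ⟨g, (congrArg (fun k ↦ k ≫ e.hom) hg).trans ?_⟩
  rw [Category.assoc, e.inv_hom_id, Category.comp_id]

lemma small_hom_dCone {P₁ P₀ : ModuleCat.{u} A} [Projective P₁] [Projective P₀] (d : P₁ ⟶ P₀)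
    (X : DerivedCategory (ModuleCat.{u} A)) : Small.{u} (dCone d ⟶ X) := by
  obtain ⟨g, h, hT⟩ := dCone_distTriang d
  have := small_hom_singleFunctor P₀ X
  have : Small.{u} (((singleFunctor (ModuleCat.{u} A) 0).obj P₁)⟦(1 : ℤ)⟧ ⟶ X) := by
    have := small_hom_singleFunctor P₁ (X⟦(-1 : ℤ)⟧)
    let e : ((singleFunctor (ModuleCat.{u} A) 0).obj P₁)⟦(1 : ℤ)⟧⟦(-1 : ℤ)⟧ ≅
        (singleFunctor (ModuleCat.{u} A) 0).obj P₁ := (shiftFunctorCompIsoId (DerivedCategory (ModuleCat.{u} A)) 1 (-1) (by lia)).app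
      ((singleFunctor (ModuleCat.{u} A) 0).obj P₁)
    refine small_of_injective.{u} (f := fun k ↦ e.inv ≫ (shiftFunctor _ (-1 : ℤ)).map k) fun k l hkl ↦ ?_
    exact (shiftFunctor _ (-1 : ℤ)).map_injective ((cancel_epi e.inv).1 hkl)
  let r (f : dCone d ⟶ X) := g ≫ f
  have hr (y : Set.range r) : ∃ f, r f = y := y.2
  choose s hs using hr
  -- A morphism is fixed by its restriction to P₀, with a chosen extension s, up to a correction
  -- coming from P₁[1].
  refine small_of_surjective.{u} (f := fun y : Set.range r ×
    (((singleFunctor (ModuleCat.{u} A) 0).obj P₁)⟦(1 : ℤ)⟧ ⟶ X) ↦ s y.1 + h ≫ y.2) fun f ↦ ?_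
  obtain ⟨k, hk⟩ := distTriang_desc₁ hT (f - s ⟨r f, f, rfl⟩) (by
    rw [Preadditive.comp_sub, sub_eq_zero]
    exact (hs ⟨r f, f, rfl⟩).symm)
  exact ⟨(⟨r f, f, rfl⟩, k), (congrArg (s _ + ·) hk.symm).trans (add_sub_cancel _ _)⟩

lemma homFunctor_isEquivalence (hP : InducesTStructure P) (hfin : HasFiniteSupports.{u} P)
    (hP₀ : homLE P 0 P) (hsmall : ∀ X, Small.{u} (P ⟶ X)) :
    ∃ h : ∀ X, isSmallModule.{u} (End P)ᵐᵒᵖ ((homFunctor P).obj X),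
      ((isSmallModule.{u} (End P)ᵐᵒᵖ).lift (homFunctor P) h).IsEquivalence := by
  have h (X) : isSmallModule.{u} (End P)ᵐᵒᵖ ((homFunctor P).obj X) := hsmall X.obj
  have : (homFunctor P).Faithful := ⟨fun {X Y f g} hfg ↦ by
    apply (homHeart P).ι.map_injective
    rw [← sub_eq_zero]
    refine hP.eq_zero_of_homLE_of_homGE hfin hP₀ X.property.1 Y.property.2 (f.hom - g.hom)
      fun x ↦ ?_
    rw [Preadditive.comp_sub, sub_eq_zero]
    exact congrArg (fun φ ↦ φ.hom x) hfg⟩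
  have : (homFunctor P).Full := ⟨fun {X Y} φ ↦ by
    obtain ⟨f, hf⟩ := hP.exists_eq_postcomp hfin hP₀ X.property Y.property φ.hom
    exact ⟨ObjectProperty.homMk f, ModuleCat.hom_ext (LinearMap.ext hf)⟩⟩
  refine ⟨h, { essSurj := ⟨fun M ↦ ?_⟩ }⟩
  have : Small.{u} M.obj := M.property
  obtain ⟨X, hX, ⟨e⟩⟩ := hP.exists_linearEquiv hfin hP₀ M.obj
  exact ⟨⟨X, hX⟩, ⟨ObjectProperty.isoMk _ e.toModuleIso⟩⟩

end Derived

end TwoTermComplex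

open TwoTermComplex in
theorem theorem3p8 {A : Type u} [Ring A] [HasDerivedCategory.{w} (ModuleCat.{u} A)]
    {P₁ P₀ : ModuleCat.{u} A} (d : P₁ ⟶ P₀)
    (hproj₁ : Projective P₁) (hsmall₁ : HomCommutesWithDirectSums.{u} P₁)
    (hproj₀ : Projective P₀) (hsmall₀ : HomCommutesWithDirectSums.{u} P₀)
    (hXY : ∀ M : ModuleCat.{u} A, classX (dCone d) M → classY (dCone d) M → IsZero M)
    (hH : classX (dCone d) ((cone d).homology 0)) :
    -- the shifts of the complex form a generating set for the derived category
    IsGeneratingSet.{u} (shifts (dCone d)) ∧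
    -- the heart is admissible abelian, and in particular an abelian category
    (IsAdmissibleAbelian (homHeart (dCone d)) ∧
      ∃ ab : Abelian (homHeart (dCone d)).FullSubcategory,
        ab.toPreadditive = (inferInstance : Preadditive (homHeart (dCone d)).FullSubcategory)) ∧
    -- the torsion theory for the heart
    (derivedYShift (dCone d) ≤ homHeart (dCone d) ∧
      derivedX (dCone d) ≤ homHeart (dCone d) ∧
      IsTorsionTheory ((derivedYShift (dCone d)).inverseImage (homHeart (dCone d)).ι)
        ((derivedX (dCone d)).inverseImage (homHeart (dCone d)).ι)) ∧
    -- the equivalence with modules over the opposite endomorphism ring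
    (∃ h : ∀ X, isSmallModule.{u} (End (dCone d))ᵐᵒᵖ ((homFunctor (dCone d)).obj X),
      ((isSmallModule.{u} (End (dCone d))ᵐᵒᵖ).lift (homFunctor (dCone d)) h).IsEquivalence) := by
  have hP := isTwoTerm_dCone d
  have hfin := hasFiniteSupports_dCone hsmall₁ hsmall₀ d
  obtain ⟨N, p, hp, ⟨e⟩⟩ := exists_isTopModule_dCone d
  -- The homology of the complex is identified with the top truncation N of the derived object,
  -- where the hypothesis on H^0 is used.
  have hN : classX (dCone d) N := classX_of_iso e hH
  have hT : InducesTStructure (dCone d) :=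
    ⟨fun _ _ hU hV f ↦ hP.hom_eq_zero_of_homLE_of_homGE hXY hU hV f,
      hP.exists_truncation hfin hp hN⟩
  refine ⟨hP.isGeneratingSet_shifts hXY hfin,
    ⟨hT.isAdmissibleAbelian_homHeart, hT.abelianHomHeart, hT.abelianHomHeart_toPreadditive⟩,
    ⟨hP.derivedYShift_le, hP.derivedX_le, hP.isTorsionTheory hXY hT⟩,
    homFunctor_isEquivalence hT hfin (hP.homLE_self hp hN) (small_hom_dCone d)⟩
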